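/- For a finite set $L$ of distinct lines in the Euclidean plane, a triangle formed by $L$ is a triple of lines of $L$ that intersect pairwise and have no common point; its area is the area of the triangle spanned by the three intersection points. (Parallel lines and concurrent triples are allowed in $L$; they just do not give triangles.) A minimum-area triangle of $L$ is a triangle formed by $L$ whose area is minimum among all triangles formed by $L$. Let $m(n)$ be the maximum, over all sets $L$ of $n$ lines, of the number of minimum-area triangles of $L$. Then for every integer $n\ge 6$ this maximum exists and $$\left\lfloor \frac{n^2-n}{6}\right\rfloor \le m(n)\le \left\lfloor \frac{n^2-2n}{3}\right\rfloor .$$ -/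

import Mathlib

open MeasureTheory

/-- The Euclidean plane. -/
abbrev Plane : Type := EuclideanSpace ℝ (Fin 2)

/-- A line of the plane: an affine subspace whose direction has dimension one
(such a subspace is automatically nonempty). -/
def IsLine (a : AffineSubspace ℝ Plane) : Prop :=
  Module.finrank ℝ a.direction = 1

/-- `L` is a family of `n` (distinct) lines in the plane. No general position is assumed. -/
def IsLineArrangement (n : ℕ) (L : Finset (AffineSubspace ℝ Plane)) : Prop :=
  L.card = n ∧ ∀ a ∈ L, IsLine a

/-- The three lines of `T` form a (nondegenerate) triangle: any two of them meet,
and there is no point common to all of them. -/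
def FormsTriangle (T : Finset (AffineSubspace ℝ Plane)) : Prop :=
  T.card = 3 ∧ (∀ a ∈ T, IsLine a) ∧
    (∀ a ∈ T, ∀ b ∈ T, a ≠ b → ∃ p : Plane, p ∈ a ∧ p ∈ b) ∧
    ¬ ∃ p : Plane, ∀ a ∈ T, p ∈ a

/-- The vertices determined by the lines of `T`: the points lying on two distinct lines of `T`. -/
def triangleVertices (T : Finset (AffineSubspace ℝ Plane)) : Set Plane :=
  {p | ∃ a ∈ T, ∃ b ∈ T, a ≠ b ∧ p ∈ a ∧ p ∈ b}

/-- The area of the triangle formed by the lines of `T`: the Lebesgue measure of the convex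
hull of its vertices. -/
noncomputable def triangleArea (T : Finset (AffineSubspace ℝ Plane)) : ℝ :=
  (volume : Measure Plane).real (convexHull ℝ (triangleVertices T))

open Classical in
/-- The triangles formed by three lines of `L`, each given by its triple of lines. -/
noncomputable def trianglesOf (L : Finset (AffineSubspace ℝ Plane)) :
    Finset (Finset (AffineSubspace ℝ Plane)) :=
  (L.powersetCard 3).filter FormsTriangle

open Classical in
/-- The triangles formed by lines of `L` whose area is minimum among all triangles formed by
lines of `L`. -/
noncomputable def minAreaTriangles (L : Finset (AffineSubspace ℝ Plane)) :
    Finset (Finset (AffineSubspace ℝ Plane)) :=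
  (trianglesOf L).filter fun T => ∀ T' ∈ trianglesOf L, triangleArea T ≤ triangleArea T'

/-- The numbers of minimum-area triangles that occur for arrangements of `n` lines. -/
def minAreaCounts (n : ℕ) : Set ℕ :=
  {k | ∃ L : Finset (AffineSubspace ℝ Plane),
    IsLineArrangement n L ∧ (minAreaTriangles L).card = k}

/-- `m(n)`: the largest possible number of minimum-area triangles formed by `n` lines. -/
noncomputable def maxMinAreaTriangles (n : ℕ) : ℕ := sSup (minAreaCounts n)

/-! The upper bound is a weighted double count of the oriented edges of minimum-area triangles. A
line of `L` that meets the relative interior of a side of such a triangle must be the line of that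
side, since otherwise it would cut off a smaller triangle at an end of the side
(`IsMinTri.mem_of_mem_side`). Hence a segment is a side of at most two minimum-area triangles, one
on each side of it, and along a given ray from a point at most one minimum-area edge starts.

Write d(P) for the number of lines through P and give an oriented edge (P, Q) the weight (d(P) - 1)
/ 2, shared equally among the minimum-area triangles containing it. Every such triangle receives at
least 3 (`IsMinTriFamily.three_le_sum_edgeWeight`): with all sides unshared this is d ≥ 2 at the
vertices, and each shared side forces larger degrees, because the neighbouring triangle needs lines
through the common vertices. Conversely, on a line a and in one of its two directions, a line other
than a passes through the start of at most one edge, and some line through the last endpoint passes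
through none (`sum_card_ray_le`). So the values d(P) - 1 add up to at most 2(n - 2) per line, and
three times the number of triangles is at most n(n - 2).

The lower bound comes from a hexagonal piece of an affine trihexagonal tiling: x = i, y = j and x +
y = k + s + 1/2. A triangle uses one line of each kind and has doubled area (k + s + 1/2 - i - j)² ≥
1/4, with equality exactly when i + j is k + s or k + s + 1. Counting such triples and choosing the
three family sizes according to n mod 6 gives the bound. -/

/-! ### Signed area and incidence with lines. -/

/-- Twice the signed area of the triangle `P Q R`. -/
def cross (P Q R : Plane) : ℝ :=
  (Q 0 - P 0) * (R 1 - P 1) - (Q 1 - P 1) * (R 0 - P 0)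

lemma plane_ext {P Q : Plane} (h0 : P 0 = Q 0) (h1 : P 1 = Q 1) : P = Q := by
  ext i; fin_cases i <;> assumption

lemma cross_swap (P Q R : Plane) : cross Q P R = -cross P Q R := by
  unfold cross; ring

lemma cross_rotate (P Q R : Plane) : cross Q R P = cross P Q R := by
  unfold cross; ring

lemma cross_eq_zero_iff {P Q Z : Plane} (hPQ : P ≠ Q) :
    cross P Q Z = 0 ↔ ∃ r : ℝ, Z = P + r • (Q - P) := by
  constructor
  · intro h
    unfold cross at h
    by_cases h0 : Q 0 - P 0 = 0
    · have h1 : Q 1 - P 1 ≠ 0 := by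
        intro h1
        exact hPQ (plane_ext (by linarith) (by linarith))
      have h2 : Z 0 - P 0 = 0 := by
        rw [h0] at h
        have : (Q 1 - P 1) * (Z 0 - P 0) = 0 := by linarith
        exact (mul_eq_zero.1 this).resolve_left h1
      refine ⟨(Z 1 - P 1) / (Q 1 - P 1), plane_ext ?_ ?_⟩
      · simp [h0]; linarith
      · simp; field_simp; ring
    · refine ⟨(Z 0 - P 0) / (Q 0 - P 0), plane_ext ?_ ?_⟩
      · simp; field_simp; ring
      · simp; field_simp; linarith
  · rintro ⟨r, rfl⟩
    simp [cross]; ring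

lemma IsLine.eq_affineSpan {a : AffineSubspace ℝ Plane} (ha : IsLine a) {P Q : Plane}
    (hP : P ∈ a) (hQ : Q ∈ a) (hPQ : P ≠ Q) : a = line[ℝ, P, Q] := by
  have hle : line[ℝ, P, Q] ≤ a := affineSpan_pair_le_of_mem_of_mem hP hQ
  symm
  refine AffineSubspace.eq_of_direction_eq_of_nonempty_of_le ?_ ⟨P, left_mem_affineSpan_pair ℝ P Q⟩ hle
  apply Submodule.eq_of_le_of_finrank_eq (AffineSubspace.direction_le hle)
  have : Module.finrank ℝ a.direction = 1 := ha
  rw [this, direction_affineSpan, vectorSpan_pair, finrank_span_singleton]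
  simpa [sub_eq_zero] using hPQ

lemma mem_affineSpan_pair_iff_cross {P Q Z : Plane} (hPQ : P ≠ Q) :
    Z ∈ line[ℝ, P, Q] ↔ cross P Q Z = 0 := by
  rw [cross_eq_zero_iff hPQ, mem_affineSpan_pair_iff_exists_lineMap_eq]
  simp only [AffineMap.lineMap_apply, vsub_eq_sub, vadd_eq_add]
  constructor
  · rintro ⟨r, rfl⟩; exact ⟨r, add_comm _ _⟩
  · rintro ⟨r, rfl⟩; exact ⟨r, add_comm _ _⟩

lemma IsLine.mem_iff {a : AffineSubspace ℝ Plane} (ha : IsLine a) {P Q : Plane}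
    (hP : P ∈ a) (hQ : Q ∈ a) (hPQ : P ≠ Q) (Z : Plane) : Z ∈ a ↔ cross P Q Z = 0 := by
  conv_lhs => rw [ha.eq_affineSpan hP hQ hPQ]
  exact mem_affineSpan_pair_iff_cross hPQ

lemma IsLine.eq_of_mem {a b : AffineSubspace ℝ Plane} (ha : IsLine a) (hb : IsLine b) {P Q : Plane}
    (hPQ : P ≠ Q) (hPa : P ∈ a) (hQa : Q ∈ a) (hPb : P ∈ b) (hQb : Q ∈ b) : a = b := by
  rw [ha.eq_affineSpan hPa hQa hPQ, hb.eq_affineSpan hPb hQb hPQ]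

lemma IsLine.point_unique {a b : AffineSubspace ℝ Plane} (ha : IsLine a) (hb : IsLine b)
    (hab : a ≠ b) {P Q : Plane} (hPa : P ∈ a) (hPb : P ∈ b) (hQa : Q ∈ a) (hQb : Q ∈ b) :
    P = Q := by
  by_contra h
  exact hab (ha.eq_of_mem hb h hPa hQa hPb hQb)

lemma IsLine.exists_ne {a : AffineSubspace ℝ Plane} (ha : IsLine a) :
    ∃ P ∈ a, ∃ Q ∈ a, P ≠ Q := by
  have h1 : Module.finrank ℝ a.direction = 1 := ha
  have hne : (a : Set Plane).Nonempty := by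
    rw [AffineSubspace.nonempty_iff_ne_bot]
    rintro rfl
    rw [AffineSubspace.direction_bot, finrank_bot] at h1
    exact zero_ne_one h1
  obtain ⟨P, hP⟩ := hne
  have : a.direction ≠ ⊥ := by
    intro h; rw [h] at h1; simp at h1
  obtain ⟨v, hv, hv0⟩ := Submodule.exists_mem_ne_zero_of_ne_bot this
  exact ⟨P, hP, v +ᵥ P, AffineSubspace.vadd_mem_of_mem_direction hv hP, by simpa using hv0⟩

lemma isLine_affineSpan_pair {P Q : Plane} (h : P ≠ Q) : IsLine line[ℝ, P, Q] := by
  unfold IsLine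
  rw [direction_affineSpan, vectorSpan_pair, finrank_span_singleton]
  simpa [sub_eq_zero] using h

/-! ### Area as a fixed multiple of the absolute signed area. -/

/-- The linear map sending the standard basis to `u, v`. -/
noncomputable def frameMap (u v : Plane) : Plane →ₗ[ℝ] Plane :=
  Matrix.toLin (EuclideanSpace.basisFun (Fin 2) ℝ).toBasis
    (EuclideanSpace.basisFun (Fin 2) ℝ).toBasis !![u 0, v 0; u 1, v 1]

lemma frameMap_det (u v : Plane) : LinearMap.det (frameMap u v) = u 0 * v 1 - v 0 * u 1 := by
  rw [frameMap, LinearMap.det_toLin, Matrix.det_fin_two_of]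

lemma frameMap_apply (u v x : Plane) : frameMap u v x = x 0 • u + x 1 • v := by
  rw [frameMap, Matrix.toLin_apply]
  apply plane_ext <;>
  · simp [Fin.sum_univ_two, Matrix.mulVec, dotProduct]
    ring

/-- The standard triangle. -/
noncomputable def stdTriangle : Set Plane :=
  convexHull ℝ {0, EuclideanSpace.single 0 1, EuclideanSpace.single 1 1}

lemma stdTriangle_pos : 0 < (volume : Measure Plane).real stdTriangle := by
  have hcomp : IsCompact stdTriangle := (Set.toFinite _).isCompact_convexHull ℝ
  have hint : (interior stdTriangle).Nonempty := by
    rw [stdTriangle, interior_convexHull_nonempty_iff_affineSpan_eq_top]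
    rw [AffineSubspace.affineSpan_eq_top_iff_vectorSpan_eq_top_of_nontrivial, eq_top_iff]
    intro x _
    have h0 : (EuclideanSpace.single 0 1 : Plane) ∈ vectorSpan ℝ
        {(0 : Plane), EuclideanSpace.single 0 1, EuclideanSpace.single 1 1} := by
      simpa using vsub_mem_vectorSpan ℝ (s := {(0 : Plane), EuclideanSpace.single 0 1,
        EuclideanSpace.single 1 1}) (p₁ := EuclideanSpace.single 0 1) (p₂ := 0) (by simp) (by simp)
    have h1 : (EuclideanSpace.single 1 1 : Plane) ∈ vectorSpan ℝ
        {(0 : Plane), EuclideanSpace.single 0 1, EuclideanSpace.single 1 1} := by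
      simpa using vsub_mem_vectorSpan ℝ (s := {(0 : Plane), EuclideanSpace.single 0 1,
        EuclideanSpace.single 1 1}) (p₁ := EuclideanSpace.single 1 1) (p₂ := 0) (by simp) (by simp)
    have : x = x 0 • EuclideanSpace.single 0 1 + x 1 • EuclideanSpace.single 1 1 := by
      apply plane_ext <;> simp
    rw [this]
    exact add_mem (Submodule.smul_mem _ _ h0) (Submodule.smul_mem _ _ h1)
  refine ENNReal.toReal_pos ?_ hcomp.measure_lt_top.ne
  exact (Measure.measure_pos_of_nonempty_interior _ hint).ne'

/-- An affine map carries the standard triangle to this one and scales volume by its determinant.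
Areas are only compared, so only positivity of the constant matters and its value is never computed.
-/
lemma volume_real_triangle (P Q R : Plane) :
    (volume : Measure Plane).real (convexHull ℝ {P, Q, R}) =
      (volume : Measure Plane).real stdTriangle * |cross P Q R| := by
  have himg : convexHull ℝ {P, Q, R} =
      (fun x => P + x) '' (frameMap (Q - P) (R - P) '' stdTriangle) := by
    rw [stdTriangle, ← Set.image_comp]
    have : ((fun x => P + x) ∘ (frameMap (Q - P) (R - P)) : Plane → Plane) =
        (AffineMap.const ℝ Plane P + (frameMap (Q - P) (R - P)).toAffineMap : Plane →ᵃ[ℝ] Plane) := by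
      ext; simp
    rw [this, AffineMap.image_convexHull]
    congr 1
    simp [Set.image_insert_eq, frameMap_apply]
  rw [himg, measureReal_def, measureReal_def, Set.image_add_left, measure_preimage_add,
    Measure.addHaar_image_linearMap, frameMap_det, ENNReal.toReal_mul,
    ENNReal.toReal_ofReal (abs_nonneg _), mul_comm]
  congr 2
  simp [cross]; ring

/-! ### Minimum-area triangles: no line crosses a side. -/

variable {L : Finset (AffineSubspace ℝ Plane)} {P Q R : Plane}

lemma add_smul_sub_mem {a : AffineSubspace ℝ Plane} {P Q : Plane} (hP : P ∈ a) (hQ : Q ∈ a)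
    (r : ℝ) : P + r • (Q - P) ∈ a := by
  have := AffineMap.lineMap_mem r hP hQ
  rwa [AffineMap.lineMap_apply, vsub_eq_sub, vadd_eq_add, add_comm] at this

/-- The points `P, Q, R` are the vertices of a triangle whose sides are on lines of `L`. -/
structure IsTri (L : Finset (AffineSubspace ℝ Plane)) (P Q R : Plane) : Prop where
  ne : cross P Q R ≠ 0
  line₁ : ∃ a ∈ L, Q ∈ a ∧ R ∈ a
  line₂ : ∃ a ∈ L, P ∈ a ∧ R ∈ a
  line₃ : ∃ a ∈ L, P ∈ a ∧ Q ∈ a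

/-- `P, Q, R` are the vertices of a triangle of minimum area formed by `L`. -/
structure IsMinTri (L : Finset (AffineSubspace ℝ Plane)) (P Q R : Plane) : Prop
    extends IsTri L P Q R where
  min : ∀ X Y Z, IsTri L X Y Z → |cross P Q R| ≤ |cross X Y Z|


lemma IsTri.swap (h : IsTri L P Q R) : IsTri L Q P R where
  ne := by rw [cross_swap]; exact neg_ne_zero.2 h.ne
  line₁ := h.line₂
  line₂ := h.line₁
  line₃ := by obtain ⟨a, ha, h1, h2⟩ := h.line₃; exact ⟨a, ha, h2, h1⟩

lemma IsTri.rotate (h : IsTri L P Q R) : IsTri L Q R P where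
  ne := by rw [cross_rotate]; exact h.ne
  line₁ := by obtain ⟨a, ha, h1, h2⟩ := h.line₂; exact ⟨a, ha, h2, h1⟩
  line₂ := by obtain ⟨a, ha, h1, h2⟩ := h.line₃; exact ⟨a, ha, h2, h1⟩
  line₃ := h.line₁

lemma IsMinTri.swap (h : IsMinTri L P Q R) : IsMinTri L Q P R where
  toIsTri := h.toIsTri.swap
  min := by rw [cross_swap, abs_neg]; exact h.min

lemma IsMinTri.rotate (h : IsMinTri L P Q R) : IsMinTri L Q R P where
  toIsTri := h.toIsTri.rotate
  min := by rw [cross_rotate]; exact h.min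

lemma IsTri.ne₁₂ (h : IsTri L P Q R) : P ≠ Q := by
  rintro rfl; exact h.ne (by unfold cross; ring)

lemma IsTri.ne₂₃ (h : IsTri L P Q R) : Q ≠ R := h.rotate.ne₁₂

lemma IsTri.ne₁₃ (h : IsTri L P Q R) : P ≠ R := h.swap.ne₂₃

lemma IsMinTri.abs_cross_eq {X Y Z : Plane} (h : IsMinTri L P Q R) (h' : IsMinTri L X Y Z) :
    |cross P Q R| = |cross X Y Z| :=
  le_antisymm (h.min _ _ _ h'.toIsTri) (h'.min _ _ _ h.toIsTri)

lemma cross_add_smul (X Y P Q : Plane) (r : ℝ) :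
    cross X Y (P + r • (Q - P)) = (1 - r) * cross X Y P + r * cross X Y Q := by
  simp [cross]; ring

/-- The sign condition `hR` puts R on Q's side of j, or on j. So j separates P from Q and also meets
PR at some P + y(R - P) with 0 < y ≤ 1, cutting off at P a triangle whose area is the fraction xy <
1 of the original. -/
lemma IsMinTri.false_of_cut (hL : ∀ a ∈ L, IsLine a) (h : IsMinTri L P Q R)
    {j : AffineSubspace ℝ Plane} (hj : j ∈ L) {X Y : Plane} (hXY : X ≠ Y) (hX : X ∈ j) (hY : Y ∈ j)
    {x : ℝ} (hx0 : 0 < x) (hx1 : x < 1) (hXx : X = P + x • (Q - P)) (hQ : cross X Y Q ≠ 0)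
    (hR : 0 ≤ cross X Y R * cross X Y Q) : False := by
  set p := cross X Y P with hp
  set q := cross X Y Q with hq
  set r := cross X Y R with hr
  have h0 : (1 - x) * p + x * q = 0 := by
    rw [hp, hq, ← cross_add_smul, ← hXx]; unfold cross; ring
  have hp1 : p = -(x / (1 - x)) * q := by
    have : (1 - x) ≠ 0 := by linarith
    field_simp; linarith
  have hc : 0 < x / (1 - x) := div_pos hx0 (by linarith)
  have hqq : 0 < q * q := mul_self_pos.2 hQ
  have hpr : p ≠ r := by
    intro e
    rw [← e, hp1] at hR
    nlinarith [mul_pos hc hqq]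
  have hpr' : p - r ≠ 0 := sub_ne_zero.2 hpr
  -- Interpolating the signed distances p and r to j along PR gives the crossing parameter p / (p -
  -- r); it equals 1 when R lies on j.
  have hy : ∃ y : ℝ, 0 < y ∧ y ≤ 1 ∧ (1 - y) * p + y * r = 0 := by
    refine ⟨p / (p - r), ?_, ?_, by field_simp; ring⟩
    · have : p / (p - r) = (p * (p - r)) / (p - r) ^ 2 := by field_simp
      rw [this]
      apply div_pos _ (by positivity)
      rw [hp1]
      nlinarith [mul_pos hc hqq, mul_pos (mul_pos hc hc) hqq, mul_nonneg hc.le hR]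
    · have : p / (p - r) = 1 + (r * (p - r)) / (p - r) ^ 2 := by field_simp; ring
      rw [this]
      have : (r * (p - r)) / (p - r) ^ 2 ≤ 0 := by
        apply div_nonpos_of_nonpos_of_nonneg _ (by positivity)
        rw [hp1]
        nlinarith [mul_nonneg hc.le hR, mul_self_nonneg r]
      linarith
  obtain ⟨y, hy0, hy1, hyr⟩ := hy
  have hcr : cross P X (P + y • (R - P)) = x * y * cross P Q R := by
    rw [hXx]; simp [cross]; ring
  have htri : IsTri L P X (P + y • (R - P)) := by
    refine ⟨?_, ?_, ?_, ?_⟩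
    · rw [hcr]; exact mul_ne_zero (mul_pos hx0 hy0).ne' h.ne
    · refine ⟨j, hj, hX, ?_⟩
      rw [(hL j hj).mem_iff hX hY hXY, cross_add_smul]
      exact hyr
    · obtain ⟨b, hb, h1, h2⟩ := h.line₂
      exact ⟨b, hb, h1, add_smul_sub_mem h1 h2 y⟩
    · obtain ⟨b, hb, h1, h2⟩ := h.line₃
      exact ⟨b, hb, h1, hXx ▸ add_smul_sub_mem h1 h2 x⟩
  have := h.min _ _ _ htri
  rw [hcr, abs_mul, abs_of_pos (mul_pos hx0 hy0)] at this
  have h3 : 0 < |cross P Q R| := abs_pos.2 h.ne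
  have h4 : x * y < 1 := by nlinarith
  nlinarith

/-- No line of `L` crosses the interior of a side of a minimum-area triangle. -/
lemma IsMinTri.mem_of_mem_side (hL : ∀ a ∈ L, IsLine a) (h : IsMinTri L P Q R)
    {j : AffineSubspace ℝ Plane} (hj : j ∈ L) {x : ℝ} (hx0 : 0 < x) (hx1 : x < 1)
    (hX : P + x • (Q - P) ∈ j) : Q ∈ j := by
  by_contra hQ
  set X := P + x • (Q - P) with hXdef
  obtain ⟨Y, hY, hXY⟩ : ∃ Y ∈ j, X ≠ Y := by
    obtain ⟨Y, hY, Z, hZ, hYZ⟩ := (hL j hj).exists_ne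
    by_cases h1 : X = Y
    · exact ⟨Z, hZ, h1 ▸ hYZ⟩
    · exact ⟨Y, hY, h1⟩
  have hQ0 : cross X Y Q ≠ 0 := fun e => hQ (((hL j hj).mem_iff hX hY hXY Q).2 e)
  have h0 : (1 - x) * cross X Y P + x * cross X Y Q = 0 := by
    rw [← cross_add_smul, ← hXdef]; unfold cross; ring
  -- Either R is weakly on Q's side of j and j cuts off a triangle at P, or it is weakly on P's side
  -- and the roles of P and Q are exchanged.
  rcases le_total 0 (cross X Y R * cross X Y Q) with hR | hR
  · exact h.false_of_cut hL hj hXY hX hY hx0 hx1 hXdef hQ0 hR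
  · have hP : cross X Y P = -(x / (1 - x)) * cross X Y Q := by
      have : (1 - x) ≠ 0 := by linarith
      field_simp; linarith
    have hc : 0 < x / (1 - x) := div_pos hx0 (by linarith)
    refine h.swap.false_of_cut hL hj hXY hX hY (x := 1 - x) (by linarith) (by linarith) ?_ ?_ ?_
    · rw [hXdef]; apply plane_ext <;> simp <;> ring
    · rw [hP]; exact mul_ne_zero (neg_ne_zero.2 hc.ne') hQ0
    · rw [hP]; nlinarith [mul_nonneg hc.le (neg_nonneg.2 hR)]

lemma exists_eq_add_smul_of_cross_eq (hPQ : P ≠ Q) {X Y : Plane} (h : cross P Q X = cross P Q Y) :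
    ∃ s : ℝ, Y = X + s • (Q - P) := by
  have : cross P Q (P + (Y - X)) = 0 := by
    have : cross P Q (P + (Y - X)) = cross P Q Y - cross P Q X := by simp [cross]; ring
    rw [this, h, sub_self]
  obtain ⟨s, hs⟩ := (cross_eq_zero_iff hPQ).1 this
  refine ⟨s, ?_⟩
  have := add_left_cancel hs
  rw [← this]; abel

/-- Equal areas on the same side put the two apexes on a parallel to PQ. If they differ, the side
from P to the shifted apex crosses the open segment RQ, which no line of `L` other than that side
may do. -/
lemma IsMinTri.not_shift (hL : ∀ a ∈ L, IsLine a) {s : ℝ} (hs : 0 < s) (h : IsMinTri L P Q R)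
    (h' : IsMinTri L P Q (R + s • (Q - P))) : False := by
  obtain ⟨j, hj, hPj, hRj⟩ := h'.line₂
  have hmem : R + (s / (1 + s)) • (Q - R) ∈ j := by
    have := add_smul_sub_mem hPj hRj (1 / (1 + s))
    convert this using 1
    have : (1 + s) ≠ 0 := by positivity
    apply plane_ext <;> simp <;> field_simp <;> ring
  have h1 : 0 < s / (1 + s) := by positivity
  have h2 : s / (1 + s) < 1 := by rw [div_lt_one (by positivity)]; linarith
  have hQj : Q ∈ j := h.rotate.swap.mem_of_mem_side hL hj h1 h2 hmem
  have := ((hL j hj).mem_iff hPj hQj h.ne₁₂ _).1 hRj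
  exact h'.ne this

/-- Minimum-area triangles on the same side of a common edge coincide. -/
lemma IsMinTri.eq_of_cross_eq (hL : ∀ a ∈ L, IsLine a) {R' : Plane} (h : IsMinTri L P Q R)
    (h' : IsMinTri L P Q R') (hc : cross P Q R = cross P Q R') : R = R' := by
  obtain ⟨s, rfl⟩ := exists_eq_add_smul_of_cross_eq h.ne₁₂ hc
  rcases lt_trichotomy s 0 with hs | rfl | hs
  · refine (h'.not_shift hL (s := -s) (by linarith) ?_).elim
    simpa using h
  · simp
  · exact (h.not_shift hL hs h').elim

/-- The minimum-area triangles with an edge starting at `P` in a given direction have the same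
edge there. -/
lemma IsMinTri.eq_of_ray (hL : ∀ a ∈ L, IsLine a) {Q' R' : Plane} {s : ℝ} (hs : 0 < s)
    (h : IsMinTri L P Q R) (h' : IsMinTri L P Q' R') (hQ' : Q' - P = s • (Q - P)) : Q' = Q := by
  wlog hs1 : s ≤ 1 generalizing Q Q' R R' s
  · symm
    refine this (s := s⁻¹) (by positivity) h' h ?_ (inv_le_one_of_one_le₀ (le_of_not_ge hs1))
    rw [hQ', smul_smul, inv_mul_cancel₀ hs.ne', one_smul]
  rcases hs1.eq_or_lt with rfl | hs1
  · simpa using hQ'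
  have hQ2 : Q' = P + s • (Q - P) := by rw [← hQ']; abel
  -- After the reduction Q' is interior to PQ, so the third side of the other triangle crosses PQ
  -- there. It must then be the line PQ, making that triangle degenerate.
  obtain ⟨j, hj, hQj, hRj⟩ := h'.line₁
  have hQ3 : Q ∈ j := h.mem_of_mem_side hL hj hs hs1 (hQ2 ▸ hQj)
  have hne : Q' ≠ Q := by
    intro e
    rw [e] at hQ'
    have : (1 - s) • (Q - P) = 0 := by rw [sub_smul, one_smul, ← hQ', sub_self]
    rcases smul_eq_zero.1 this with h1 | h1
    · linarith
    · exact h.ne₁₂ (sub_eq_zero.1 h1).symm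
  have hP : P ∈ j := by
    rw [(hL j hj).mem_iff hQj hQ3 hne, hQ2]
    simp [cross]; ring
  exact (h'.ne (((hL j hj).mem_iff hP hQj h'.ne₁₂ _).1 hRj)).elim

/-! ### Vertex degrees forced by shared sides. -/

open Classical in
/-- The number of lines of `L` through a point. -/
noncomputable def lineDegree (L : Finset (AffineSubspace ℝ Plane)) (P : Plane) : ℕ :=
  (L.filter (P ∈ ·)).card

/-- The point with affine coordinates `u, v` in the frame `P, Q, R`. -/
noncomputable def framePoint (P Q R : Plane) (u v : ℝ) : Plane :=
  P + u • (Q - P) + v • (R - P)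

/-- All signed areas scale by the same factor in the frame, so the incidences used below become
polynomial equations in affine coordinates. -/
lemma cross_framePoint (P Q R : Plane) (u₁ v₁ u₂ v₂ u₃ v₃ : ℝ) :
    cross (framePoint P Q R u₁ v₁) (framePoint P Q R u₂ v₂) (framePoint P Q R u₃ v₃) =
      ((u₂ - u₁) * (v₃ - v₁) - (v₂ - v₁) * (u₃ - u₁)) * cross P Q R := by
  simp [cross, framePoint]; ring

lemma exists_eq_framePoint {P Q R : Plane} (h : cross P Q R ≠ 0) (X : Plane) :
    ∃ u v, X = framePoint P Q R u v := by
  refine ⟨cross P X R / cross P Q R, cross P Q X / cross P Q R, ?_⟩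
  apply plane_ext <;> simp only [framePoint, PiLp.add_apply, PiLp.smul_apply, PiLp.sub_apply,
    smul_eq_mul] <;> field_simp <;> unfold cross <;> ring

lemma framePoint_zero_zero (P Q R : Plane) : framePoint P Q R 0 0 = P := by simp [framePoint]
lemma framePoint_one_zero (P Q R : Plane) : framePoint P Q R 1 0 = Q := by simp [framePoint]
lemma framePoint_zero_one (P Q R : Plane) : framePoint P Q R 0 1 = R := by simp [framePoint]


lemma IsTri.two_le_lineDegree (hL : ∀ a ∈ L, IsLine a) (h : IsTri L P Q R) :
    2 ≤ lineDegree L P := by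
  classical
  obtain ⟨b, hb, hPb, hRb⟩ := h.line₂
  obtain ⟨c, hc, hPc, hQc⟩ := h.line₃
  have hbc : b ≠ c := by
    rintro rfl
    exact h.ne (((hL b hb).mem_iff hPc hQc h.ne₁₂ _).1 hRb)
  rw [← Finset.card_pair hbc]
  apply Finset.card_le_card
  intro x hx
  rcases Finset.mem_insert.1 hx with rfl | hx
  · simp [hb, hPb]
  · rw [Finset.mem_singleton] at hx; subst hx; simp [hc, hPc]

/-- If only two lines pass through a vertex, they are the sides of the triangle. -/
lemma IsTri.cross_eq_zero_of_lineDegree_le_two (hL : ∀ a ∈ L, IsLine a) (h : IsTri L P Q R)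
    (hd : lineDegree L P ≤ 2) {X : Plane} (hX : ∃ a ∈ L, P ∈ a ∧ X ∈ a) :
    cross P Q X = 0 ∨ cross P R X = 0 := by
  classical
  obtain ⟨b, hb, hPb, hRb⟩ := h.line₂
  obtain ⟨c, hc, hPc, hQc⟩ := h.line₃
  obtain ⟨j, hj, hPj, hXj⟩ := hX
  by_contra! hne
  have hbc : b ≠ c := by
    rintro rfl
    exact h.ne (((hL b hb).mem_iff hPc hQc h.ne₁₂ _).1 hRb)
  have hjc : j ≠ c := by
    rintro rfl
    exact hne.1 (((hL _ hc).mem_iff hPc hQc h.ne₁₂ _).1 hXj)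
  have hjb : j ≠ b := by
    rintro rfl
    exact hne.2 (((hL _ hb).mem_iff hPb hRb h.ne₁₃ _).1 hXj)
  have : ({j, b, c} : Finset (AffineSubspace ℝ Plane)).card ≤ lineDegree L P := by
    apply Finset.card_le_card
    intro x hx
    simp only [Finset.mem_insert, Finset.mem_singleton] at hx
    rcases hx with rfl | rfl | rfl <;> simp [*]
  rw [Finset.card_eq_three.2 ⟨j, b, c, hjb, hjc, hbc, rfl⟩] at this
  omega

lemma IsTri.cross_eq_zero_of_lineDegree_le_three (hL : ∀ a ∈ L, IsLine a) (h : IsTri L P Q R)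
    (hd : lineDegree L P ≤ 3) {D : Plane} (hD : ∃ a ∈ L, P ∈ a ∧ D ∈ a)
    (hQD : cross P Q D ≠ 0) (hRD : cross P R D ≠ 0) {X : Plane} (hX : ∃ a ∈ L, P ∈ a ∧ X ∈ a) :
    cross P Q X = 0 ∨ cross P R X = 0 ∨ cross P D X = 0 := by
  classical
  obtain ⟨b, hb, hPb, hRb⟩ := h.line₂
  obtain ⟨c, hc, hPc, hQc⟩ := h.line₃
  obtain ⟨d, hd', hPd, hDd⟩ := hD
  obtain ⟨j, hj, hPj, hXj⟩ := hX
  by_contra! hne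
  have hPD : P ≠ D := by
    rintro rfl
    exact hQD (by unfold cross; ring)
  have hbc : b ≠ c := by
    rintro rfl
    exact h.ne (((hL b hb).mem_iff hPc hQc h.ne₁₂ _).1 hRb)
  have hdc : d ≠ c := by
    rintro rfl
    exact hQD (((hL _ hc).mem_iff hPc hQc h.ne₁₂ _).1 hDd)
  have hdb : d ≠ b := by
    rintro rfl
    exact hRD (((hL _ hb).mem_iff hPb hRb h.ne₁₃ _).1 hDd)
  have hjc : j ≠ c := by
    rintro rfl
    exact hne.1 (((hL _ hc).mem_iff hPc hQc h.ne₁₂ _).1 hXj)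
  have hjb : j ≠ b := by
    rintro rfl
    exact hne.2.1 (((hL _ hb).mem_iff hPb hRb h.ne₁₃ _).1 hXj)
  have hjd : j ≠ d := by
    rintro rfl
    exact hne.2.2 (((hL _ hd').mem_iff hPd hDd hPD _).1 hXj)
  have : ({j, b, c, d} : Finset (AffineSubspace ℝ Plane)).card ≤ lineDegree L P := by
    apply Finset.card_le_card
    intro x hx
    simp only [Finset.mem_insert, Finset.mem_singleton] at hx
    rcases hx with rfl | rfl | rfl | rfl <;> simp [*]
  have h4 : ({j, b, c, d} : Finset (AffineSubspace ℝ Plane)).card = 4 := by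
    rw [Finset.card_insert_of_notMem (by simp [hjb, hjc, hjd]),
      Finset.card_eq_three.2 ⟨b, c, d, hbc, hdb.symm, hdc.symm, rfl⟩]
  omega

/-- There are minimum-area triangles on both sides of the edge `P Q`. -/
def IsDoubleEdge (L : Finset (AffineSubspace ℝ Plane)) (P Q R : Plane) : Prop :=
  ∃ X, IsMinTri L P Q X ∧ cross P Q X = -cross P Q R

lemma IsDoubleEdge.swap (h : IsDoubleEdge L P Q R) : IsDoubleEdge L Q P R := by
  obtain ⟨X, hX, hc⟩ := h
  exact ⟨X, hX.swap, by rw [cross_swap, hc, cross_swap P Q R]⟩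

/-- With only two lines at P and at Q, the neighbour across PQ would have its apex on both PR and
QR, that is at R, on the wrong side of PQ. -/
lemma IsMinTri.not_isDoubleEdge (hL : ∀ a ∈ L, IsLine a) (h : IsMinTri L P Q R)
    (hP : lineDegree L P ≤ 2) (hQ : lineDegree L Q ≤ 2) : ¬ IsDoubleEdge L P Q R := by
  rintro ⟨X, hX, hc⟩
  have h1 := h.toIsTri.cross_eq_zero_of_lineDegree_le_two hL hP hX.line₂
  have h2 := h.swap.toIsTri.cross_eq_zero_of_lineDegree_le_two hL hQ hX.line₁
  have h3 := h1.resolve_left hX.ne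
  have h4 := h2.resolve_left hX.swap.ne
  have : cross P Q R = cross P Q X + cross Q R X - cross P R X := by unfold cross; ring
  rw [h3, h4, hc] at this
  exact h.ne (by linarith)

/-- Simplicity of P and Q puts the apexes of both neighbours on the line PQ, and equality of areas
puts them at frame coordinates (-1, 0) and (2, 0). Together with P and Q they determine four
distinct lines through R. -/
lemma IsMinTri.not_isDoubleEdge_of_simple_simple (hL : ∀ a ∈ L, IsLine a) (h : IsMinTri L P Q R)
    (hP : lineDegree L P ≤ 2) (hQ : lineDegree L Q ≤ 2) (hR : lineDegree L R ≤ 3)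
    (hPR : IsDoubleEdge L P R Q) (hQR : IsDoubleEdge L Q R P) : False := by
  obtain ⟨X, hX, hcX⟩ := hPR
  obtain ⟨Y, hY, hcY⟩ := hQR
  have hD := h.ne
  have hX1 := (h.toIsTri.cross_eq_zero_of_lineDegree_le_two hL hP hX.line₂).resolve_right hX.ne
  have hY1 := (h.swap.toIsTri.cross_eq_zero_of_lineDegree_le_two hL hQ hY.line₂).resolve_right hY.ne
  obtain ⟨u, v, rfl⟩ := exists_eq_framePoint hD X
  obtain ⟨u', v', rfl⟩ := exists_eq_framePoint hD Y
  have e0 := framePoint_zero_zero P Q R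
  have e1 := framePoint_one_zero P Q R
  have e2 := framePoint_zero_one P Q R
  have hv : v = 0 := by
    have := cross_framePoint P Q R 0 0 1 0 u v
    rw [e0, e1, hX1] at this
    have := (mul_eq_zero.1 this.symm).resolve_right hD
    linarith
  have hv' : v' = 0 := by
    have := cross_framePoint P Q R 1 0 0 0 u' v'
    rw [e0, e1, hY1] at this
    have := (mul_eq_zero.1 this.symm).resolve_right hD
    linarith
  have hu : u = -1 := by
    have h1 := cross_framePoint P Q R 0 0 0 1 u v
    have h2 := cross_framePoint P Q R 0 0 0 1 1 0
    rw [e0, e2] at h1 h2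
    rw [e1] at h2
    rw [h1, h2] at hcX
    have : (u + 1) * cross P Q R = 0 := by linarith
    have := (mul_eq_zero.1 this).resolve_right hD
    linarith
  have hu' : u' = 2 := by
    have h1 := cross_framePoint P Q R 1 0 0 1 u' v'
    have h2 := cross_framePoint P Q R 1 0 0 1 0 0
    rw [e1, e2] at h1 h2
    rw [e0] at h2
    rw [h1, h2, hv'] at hcY
    have : (u' - 2) * cross P Q R = 0 := by linarith
    have := (mul_eq_zero.1 this).resolve_right hD
    linarith
  subst hu hv hu' hv'
  have hRtri : IsTri L R P Q := h.rotate.rotate.toIsTri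
  have hXl := hX.rotate.line₃
  have hYl := hY.rotate.line₃
  have c1 := cross_framePoint P Q R 0 1 0 0 (-1) 0
  have c2 := cross_framePoint P Q R 0 1 1 0 (-1) 0
  have c3 := cross_framePoint P Q R 0 1 0 0 2 0
  have c4 := cross_framePoint P Q R 0 1 1 0 2 0
  have c5 := cross_framePoint P Q R 0 1 (-1) 0 2 0
  rw [e2, e0] at c1 c3
  rw [e2, e1] at c2 c4
  rw [e2] at c5
  have := hRtri.cross_eq_zero_of_lineDegree_le_three hL hR hX.line₁
    (by rw [c1]; exact mul_ne_zero (by norm_num) hD)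
    (by rw [c2]; exact mul_ne_zero (by norm_num) hD) hY.line₁
  rw [c3, c4, c5] at this
  rcases this with h | h | h <;> exact (mul_ne_zero (by norm_num) hD) h

/-- In the frame, simplicity of P places the neighbours' apexes across PQ and PR at D = (0, -1) and
B = (-1, 0), while the apex E across QR satisfies x + y = 2. The three lines at Q leave only y = 0
or y = x - 1 for E, those at R only x = 0 or y = x + 1, and no combination meets x + y = 2. -/
lemma IsMinTri.not_all_isDoubleEdge (hL : ∀ a ∈ L, IsLine a) (h : IsMinTri L P Q R)
    (hP : lineDegree L P ≤ 2) (hQ : lineDegree L Q ≤ 3) (hR : lineDegree L R ≤ 3)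
    (hPQ : IsDoubleEdge L P Q R) (hPR : IsDoubleEdge L P R Q) (hQR : IsDoubleEdge L Q R P) :
    False := by
  obtain ⟨D, hD', hcD⟩ := hPQ
  obtain ⟨B, hB, hcB⟩ := hPR
  obtain ⟨E, hE, hcE⟩ := hQR
  have hD := h.ne
  have hB1 := (h.toIsTri.cross_eq_zero_of_lineDegree_le_two hL hP hB.line₂).resolve_right hB.ne
  have hD1 := (h.toIsTri.cross_eq_zero_of_lineDegree_le_two hL hP hD'.line₂).resolve_left hD'.ne
  obtain ⟨u, v, rfl⟩ := exists_eq_framePoint hD D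
  obtain ⟨u', v', rfl⟩ := exists_eq_framePoint hD B
  obtain ⟨x, y, rfl⟩ := exists_eq_framePoint hD E
  have e0 := framePoint_zero_zero P Q R
  have e1 := framePoint_one_zero P Q R
  have e2 := framePoint_zero_one P Q R
  have hu : u = 0 := by
    have := cross_framePoint P Q R 0 0 0 1 u v
    rw [e0, e2, hD1] at this
    have := (mul_eq_zero.1 this.symm).resolve_right hD
    linarith
  have hv' : v' = 0 := by
    have := cross_framePoint P Q R 0 0 1 0 u' v'
    rw [e0, e1, hB1] at this
    have := (mul_eq_zero.1 this.symm).resolve_right hD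
    linarith
  have hv : v = -1 := by
    have h1 := cross_framePoint P Q R 0 0 1 0 u v
    rw [e0, e1] at h1
    rw [h1] at hcD
    have : (v + 1) * cross P Q R = 0 := by linarith
    have := (mul_eq_zero.1 this).resolve_right hD
    linarith
  have hu' : u' = -1 := by
    have h1 := cross_framePoint P Q R 0 0 0 1 u' v'
    have h2 := cross_framePoint P Q R 0 0 0 1 1 0
    rw [e0, e2] at h1 h2
    rw [e1] at h2
    rw [h1, h2] at hcB
    have : (u' + 1) * cross P Q R = 0 := by linarith
    have := (mul_eq_zero.1 this).resolve_right hD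
    linarith
  have hxy : x + y = 2 := by
    have h1 := cross_framePoint P Q R 1 0 0 1 x y
    have h2 := cross_framePoint P Q R 1 0 0 1 0 0
    rw [e1, e2] at h1 h2
    rw [e0] at h2
    rw [h1, h2] at hcE
    have : (x + y - 2) * cross P Q R = 0 := by linarith
    have := (mul_eq_zero.1 this).resolve_right hD
    linarith
  subst hu hv hu' hv'
  have c1 := cross_framePoint P Q R 1 0 0 1 0 (-1)
  have c2 := cross_framePoint P Q R 1 0 0 0 0 (-1)
  have c3 := cross_framePoint P Q R 1 0 0 0 x y
  have c4 := cross_framePoint P Q R 1 0 0 (-1) x y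
  have d1 := cross_framePoint P Q R 0 1 0 0 (-1) 0
  have d2 := cross_framePoint P Q R 0 1 1 0 (-1) 0
  have d3 := cross_framePoint P Q R 0 1 0 0 x y
  have d4 := cross_framePoint P Q R 0 1 (-1) 0 x y
  rw [e1, e2] at c1
  rw [e1, e0] at c2 c3
  rw [e1] at c4
  rw [e2, e0] at d1 d3
  rw [e2, e1] at d2
  rw [e2] at d4
  have hQ' := (h.rotate.toIsTri.cross_eq_zero_of_lineDegree_le_three hL hQ hD'.line₁
    (by rw [c1]; exact mul_ne_zero (by norm_num) hD)
    (by rw [c2]; exact mul_ne_zero (by norm_num) hD) hE.line₂).resolve_left hE.ne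
  have hR' := h.rotate.rotate.toIsTri.cross_eq_zero_of_lineDegree_le_three hL hR hB.line₁
    (by rw [d1]; exact mul_ne_zero (by norm_num) hD)
    (by rw [d2]; exact mul_ne_zero (by norm_num) hD) hE.line₁
  have hR'' : cross R P (framePoint P Q R x y) = 0 ∨
      cross R (framePoint P Q R (-1) 0) (framePoint P Q R x y) = 0 := by
    rcases hR' with h' | h' | h'
    · exact Or.inl h'
    · exact absurd h' hE.swap.ne
    · exact Or.inr h'
  rw [c3, c4, mul_eq_zero, mul_eq_zero] at hQ'
  rw [d3, d4, mul_eq_zero, mul_eq_zero] at hR''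
  simp only [hD, or_false] at hQ' hR''
  rcases hQ' with h1 | h1 <;> rcases hR'' with h2 | h2 <;> linarith

/-! ### Every triangle receives weight at least three. -/

open Classical in
/-- The number of members of a family of finite point sets that contain both entries of `e`. -/
noncomputable def edgeCount (F : Finset (Finset Plane)) (e : Plane × Plane) : ℕ :=
  (F.filter (e ∈ ·.offDiag)).card

lemma edgeCount_swap (F : Finset (Finset Plane)) (P Q : Plane) :
    edgeCount F (Q, P) = edgeCount F (P, Q) := by
  classical
  unfold edgeCount
  congr 1
  ext S
  simp only [Finset.mem_filter, Finset.mem_offDiag]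
  tauto

/-- Every member of `F` is the vertex set of a minimum-area triangle of `L`. -/
def IsMinTriFamily (L : Finset (AffineSubspace ℝ Plane)) (F : Finset (Finset Plane)) : Prop :=
  ∀ S ∈ F, ∃ P Q R, (∀ X, X ∈ S ↔ X = P ∨ X = Q ∨ X = R) ∧ IsMinTri L P Q R

lemma IsMinTriFamily.exists_third {F : Finset (Finset Plane)} (hF : IsMinTriFamily L F)
    {S : Finset Plane} (hS : S ∈ F) (hP : P ∈ S) (hQ : Q ∈ S) (hPQ : P ≠ Q) :
    ∃ R, (∀ X, X ∈ S ↔ X = P ∨ X = Q ∨ X = R) ∧ IsMinTri L P Q R := by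
  obtain ⟨A, B, C, hABC, h⟩ := hF S hS
  rcases (hABC P).1 hP with rfl | rfl | rfl <;> rcases (hABC Q).1 hQ with rfl | rfl | rfl
  · exact absurd rfl hPQ
  · exact ⟨C, hABC, h⟩
  · exact ⟨B, fun X => (hABC X).trans (by tauto), h.rotate.rotate.swap⟩
  · exact ⟨C, fun X => (hABC X).trans (by tauto), h.swap⟩
  · exact absurd rfl hPQ
  · exact ⟨A, fun X => (hABC X).trans (by tauto), h.rotate⟩
  · exact ⟨B, fun X => (hABC X).trans (by tauto), h.rotate.rotate⟩
  · exact ⟨A, fun X => (hABC X).trans (by tauto), h.rotate.swap⟩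
  · exact absurd rfl hPQ

/-- The apex over an edge is determined by its side of the edge, because all the areas agree. Hence
a second member of the family containing the edge lies opposite R, and there is no third. -/
lemma IsMinTriFamily.edgeCount_eq (hL : ∀ a ∈ L, IsLine a) {F : Finset (Finset Plane)}
    (hF : IsMinTriFamily L F) {S : Finset Plane} (hS : S ∈ F)
    (hSm : ∀ X, X ∈ S ↔ X = P ∨ X = Q ∨ X = R) (h : IsMinTri L P Q R) :
    edgeCount F (P, Q) = 1 ∨ edgeCount F (P, Q) = 2 ∧ IsDoubleEdge L P Q R := by
  classical
  have hSf : S ∈ F.filter ((P, Q) ∈ ·.offDiag) := by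
    simp [hS, hSm, h.ne₁₂]
  by_cases hall : ∀ S' ∈ F.filter ((P, Q) ∈ ·.offDiag), S' = S
  · left
    exact Finset.card_eq_one.2 ⟨S, Finset.eq_singleton_iff_unique_mem.2 ⟨hSf, hall⟩⟩
  push Not at hall
  have third : ∀ S' ∈ F.filter ((P, Q) ∈ ·.offDiag), S' ≠ S →
      ∃ X, (∀ Y, Y ∈ S' ↔ Y = P ∨ Y = Q ∨ Y = X) ∧ IsMinTri L P Q X ∧
        cross P Q X = -cross P Q R := by
    intro S' hS' hne
    simp only [Finset.mem_filter, Finset.mem_offDiag] at hS'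
    obtain ⟨X, hX, hXm⟩ := hF.exists_third hS'.1 hS'.2.1 hS'.2.2.1 hS'.2.2.2
    refine ⟨X, hX, hXm, ?_⟩
    rcases abs_eq_abs.1 (hXm.abs_cross_eq h) with h1 | h1
    · have := hXm.eq_of_cross_eq hL h h1
      subst this
      exact absurd (Finset.ext fun Y => (hX Y).trans (hSm Y).symm) hne
    · exact h1
  obtain ⟨S', hS', hne⟩ := hall
  obtain ⟨X, hX, hXm, hXc⟩ := third S' hS' hne
  refine Or.inr ⟨?_, X, hXm, hXc⟩
  refine Finset.card_eq_two.2 ⟨S, S', hne.symm, ?_⟩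
  ext S''
  simp only [Finset.mem_insert, Finset.mem_singleton]
  constructor
  · intro h''
    by_cases hne'' : S'' = S
    · exact Or.inl hne''
    · right
      obtain ⟨Y, hY, hYm, hYc⟩ := third S'' h'' hne''
      have := hYm.eq_of_cross_eq hL hXm (hYc.trans hXc.symm)
      subst this
      exact Finset.ext fun Z => (hY Z).trans (hX Z).symm
  · rintro (rfl | rfl) <;> assumption

/-- The contribution of an oriented edge in the double count. -/
noncomputable def edgeWeight (L : Finset (AffineSubspace ℝ Plane)) (F : Finset (Finset Plane))
    (e : Plane × Plane) : ℝ :=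
  ((lineDegree L e.1 : ℝ) - 1) / (2 * edgeCount F e)

lemma sum_offDiag_triple {S : Finset Plane} (hSm : ∀ X, X ∈ S ↔ X = P ∨ X = Q ∨ X = R)
    (hPQ : P ≠ Q) (hPR : P ≠ R) (hQR : Q ≠ R) (f : Plane × Plane → ℝ) :
    ∑ e ∈ S.offDiag, f e =
      f (P, Q) + f (Q, P) + f (P, R) + f (R, P) + f (Q, R) + f (R, Q) := by
  have : S.offDiag = {(P, Q), (Q, P), (P, R), (R, P), (Q, R), (R, Q)} := by
    ext ⟨x, y⟩
    simp only [Finset.mem_offDiag, hSm, Finset.mem_insert, Finset.mem_singleton, Prod.mk.injEq]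
    constructor
    · rintro ⟨rfl | rfl | rfl, rfl | rfl | rfl, h⟩ <;> simp_all
    · rintro (⟨rfl, rfl⟩ | ⟨rfl, rfl⟩ | ⟨rfl, rfl⟩ | ⟨rfl, rfl⟩ | ⟨rfl, rfl⟩ | ⟨rfl, rfl⟩) <;>
        simp [*, Ne.symm]
  rw [this]
  have := hPQ.symm
  have := hPR.symm
  have := hQR.symm
  repeat rw [Finset.sum_insert (by simp [*])]
  rw [Finset.sum_singleton]
  ring

lemma IsMinTriFamily.three_le_sum_edgeWeight (hL : ∀ a ∈ L, IsLine a)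
    {F : Finset (Finset Plane)} (hF : IsMinTriFamily L F) {S : Finset Plane} (hS : S ∈ F)
    : 3 ≤ ∑ e ∈ S.offDiag, edgeWeight L F e := by
  obtain ⟨P, Q, R, hSm, h⟩ := hF S hS
  rw [sum_offDiag_triple hSm h.ne₁₂ h.ne₁₃ h.ne₂₃]
  simp only [edgeWeight, edgeCount_swap F P Q, edgeCount_swap F P R, edgeCount_swap F Q R]
  have hPQ := hF.edgeCount_eq hL hS hSm h
  have hQR := hF.edgeCount_eq hL hS (fun X => (hSm X).trans (by tauto)) h.rotate
  have hPR := hF.edgeCount_eq hL hS (fun X => (hSm X).trans (by tauto)) h.swap.rotate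
  have p2 := h.two_le_lineDegree hL
  have q2 := h.rotate.two_le_lineDegree hL
  have r2 := h.rotate.rotate.two_le_lineDegree hL
  have sPQ := h.not_isDoubleEdge hL
  have sQR := h.rotate.not_isDoubleEdge hL
  have sPR := h.swap.rotate.not_isDoubleEdge hL
  have tR := h.not_isDoubleEdge_of_simple_simple hL
  have tP := h.rotate.not_isDoubleEdge_of_simple_simple hL
  have tQ := h.swap.rotate.not_isDoubleEdge_of_simple_simple hL
  have uP := h.not_all_isDoubleEdge hL
  have uQ := h.rotate.not_all_isDoubleEdge hL
  have uR := h.rotate.rotate.not_all_isDoubleEdge hL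
  generalize lineDegree L P = p at *
  generalize lineDegree L Q = q at *
  generalize lineDegree L R = r at *
  generalize edgeCount F (P, Q) = x at *
  generalize edgeCount F (P, R) = y at *
  generalize edgeCount F (Q, R) = z at *
  -- Cleared of denominators, and up to renaming vertices, the claim is p + q + r ≥ 6 with no double
  -- side, 4p + 3q + 3r ≥ 22 if only QR is double, 3p + 3q + 2r ≥ 20 if PR and QR are, and p + q + r
  -- ≥ 9 if all three are.
  rcases hPQ with rfl | ⟨rfl, dPQ⟩ <;> rcases hPR with rfl | ⟨rfl, dPR⟩ <;>
    rcases hQR with rfl | ⟨rfl, dQR⟩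
  · have : 6 ≤ p + q + r := by omega
    have : (6 : ℝ) ≤ p + q + r := by exact_mod_cast this
    push_cast; linarith
  · have : 22 ≤ 4 * p + 3 * q + 3 * r := by
      have h1 : ¬(q ≤ 2 ∧ r ≤ 2) := fun ⟨a, b⟩ => sQR a b dQR
      omega
    have : (22 : ℝ) ≤ 4 * p + 3 * q + 3 * r := by exact_mod_cast this
    push_cast; linarith
  · have : 22 ≤ 3 * p + 4 * q + 3 * r := by
      have h1 : ¬(p ≤ 2 ∧ r ≤ 2) := fun ⟨a, b⟩ => sPR a b dPR
      omega
    have : (22 : ℝ) ≤ 3 * p + 4 * q + 3 * r := by exact_mod_cast this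
    push_cast; linarith
  · have : 20 ≤ 3 * p + 3 * q + 2 * r := by
      have h1 : ¬(p ≤ 2 ∧ r ≤ 2) := fun ⟨a, b⟩ => sPR a b dPR
      have h2 : ¬(q ≤ 2 ∧ r ≤ 2) := fun ⟨a, b⟩ => sQR a b dQR
      have h3 : ¬(p ≤ 2 ∧ q ≤ 2 ∧ r ≤ 3) := fun ⟨a, b, c⟩ => tR a b c dPR dQR
      omega
    have : (20 : ℝ) ≤ 3 * p + 3 * q + 2 * r := by exact_mod_cast this
    push_cast; linarith
  · have : 22 ≤ 3 * p + 3 * q + 4 * r := by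
      have h1 : ¬(p ≤ 2 ∧ q ≤ 2) := fun ⟨a, b⟩ => sPQ a b dPQ
      omega
    have : (22 : ℝ) ≤ 3 * p + 3 * q + 4 * r := by exact_mod_cast this
    push_cast; linarith
  · have : 20 ≤ 3 * p + 2 * q + 3 * r := by
      have h1 : ¬(p ≤ 2 ∧ q ≤ 2) := fun ⟨a, b⟩ => sPQ a b dPQ
      have h2 : ¬(q ≤ 2 ∧ r ≤ 2) := fun ⟨a, b⟩ => sQR a b dQR
      have h3 : ¬(p ≤ 2 ∧ r ≤ 2 ∧ q ≤ 3) := fun ⟨a, b, c⟩ => tQ a b c dPQ dQR.swap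
      omega
    have : (20 : ℝ) ≤ 3 * p + 2 * q + 3 * r := by exact_mod_cast this
    push_cast; linarith
  · have : 20 ≤ 2 * p + 3 * q + 3 * r := by
      have h1 : ¬(p ≤ 2 ∧ q ≤ 2) := fun ⟨a, b⟩ => sPQ a b dPQ
      have h2 : ¬(p ≤ 2 ∧ r ≤ 2) := fun ⟨a, b⟩ => sPR a b dPR
      have h3 : ¬(q ≤ 2 ∧ r ≤ 2 ∧ p ≤ 3) := fun ⟨a, b, c⟩ => tP a b c dPQ.swap dPR.swap
      omega
    have : (20 : ℝ) ≤ 2 * p + 3 * q + 3 * r := by exact_mod_cast this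
    push_cast; linarith
  · have : 9 ≤ p + q + r := by
      have h1 : ¬(p ≤ 2 ∧ q ≤ 2) := fun ⟨a, b⟩ => sPQ a b dPQ
      have h2 : ¬(p ≤ 2 ∧ r ≤ 2) := fun ⟨a, b⟩ => sPR a b dPR
      have h3 : ¬(q ≤ 2 ∧ r ≤ 2) := fun ⟨a, b⟩ => sQR a b dQR
      have h4 : ¬(p ≤ 2 ∧ q ≤ 3 ∧ r ≤ 3) := fun ⟨a, b, c⟩ => uP a b c dPQ dPR dQR
      have h5 : ¬(q ≤ 2 ∧ r ≤ 3 ∧ p ≤ 3) := fun ⟨a, b, c⟩ => uQ a b c dQR dPQ.swap dPR.swap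
      have h6 : ¬(r ≤ 2 ∧ p ≤ 3 ∧ q ≤ 3) := fun ⟨a, b, c⟩ => uR a b c dPR.swap dQR.swap dPQ
      omega
    have : (9 : ℝ) ≤ p + q + r := by exact_mod_cast this
    push_cast; linarith

/-- Exchanging the order of summation, the equal shares of an edge add up to its full weight, so
each oriented edge counts once however many triangles contain it. -/
lemma IsMinTriFamily.three_mul_card_le (hL : ∀ a ∈ L, IsLine a)
    {F : Finset (Finset Plane)} (hF : IsMinTriFamily L F) :
    (3 * F.card : ℝ) ≤ ∑ e ∈ F.biUnion Finset.offDiag, ((lineDegree L e.1 : ℝ) - 1) / 2 := by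
  classical
  calc (3 * F.card : ℝ) = ∑ S ∈ F, (3 : ℝ) := by simp [mul_comm]
    _ ≤ ∑ S ∈ F, ∑ e ∈ S.offDiag, edgeWeight L F e :=
      Finset.sum_le_sum fun S hS => by
        convert hF.three_le_sum_edgeWeight hL hS
    _ = ∑ e ∈ F.biUnion Finset.offDiag, ∑ S ∈ F.filter (e ∈ ·.offDiag), edgeWeight L F e := by
      apply Finset.sum_comm'
      intro S e
      simp only [Finset.mem_filter, Finset.mem_biUnion]
      constructor
      · rintro ⟨h1, h2⟩; exact ⟨⟨h1, h2⟩, S, h1, h2⟩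
      · rintro ⟨⟨h1, h2⟩, -⟩; exact ⟨h1, h2⟩
    _ = _ := by
      apply Finset.sum_congr rfl
      intro e he
      rw [Finset.sum_const, nsmul_eq_mul, edgeWeight]
      have h0 : edgeCount F e ≠ 0 := by
        obtain ⟨S, hS, heS⟩ := Finset.mem_biUnion.1 he
        refine (Finset.card_pos.2 ⟨S, Finset.mem_filter.2 ⟨hS, ?_⟩⟩).ne'
        convert heS
      have h1 : (F.filter (e ∈ ·.offDiag)).card = edgeCount F e := by
        unfold edgeCount; congr!
      rw [h1]
      have : (edgeCount F e : ℝ) ≠ 0 := by exact_mod_cast h0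
      field_simp

/-! ### Edges along a line and the upper bound on the count. -/

/-- On a fixed line with a coordinate `g`, the starting points of the edges pointing in the
direction of increasing `g` lie on at most `n - 2` other lines in total. -/
lemma sum_card_ray_le [DecidableEq (AffineSubspace ℝ Plane)]
    [∀ P : Plane, DecidablePred fun j : AffineSubspace ℝ Plane => P ∈ j]
    (hL : ∀ a ∈ L, IsLine a) (E : Finset (Plane × Plane))
    {a : AffineSubspace ℝ Plane} (ha : a ∈ L) (g : Plane → ℝ) (D : Plane)
    (hg : ∀ Z ∈ a, ∀ W ∈ a, W - Z = (g W - g Z) • D)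
    (hE : ∀ e ∈ E, (∃ R, IsMinTri L e.1 e.2 R) ∧ e.1 ∈ a ∧ e.2 ∈ a ∧ g e.1 < g e.2) :
    ∑ e ∈ E, ((L.erase a).filter (e.1 ∈ ·)).card ≤ L.card - 2 := by
  rcases E.eq_empty_or_nonempty with rfl | hne
  · simp
  -- A line other than a meets a in one point, and only one edge in the given direction starts
  -- there.
  have hdisj : (E : Set (Plane × Plane)).PairwiseDisjoint
      (fun e => (L.erase a).filter (e.1 ∈ ·)) := by
    intro e he e' he' hee'
    rw [Function.onFun, Finset.disjoint_left]
    intro j hj hj'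
    simp only [Finset.mem_filter, Finset.mem_erase] at hj hj'
    apply hee'
    obtain ⟨⟨R, hR⟩, h1, h2, hlt⟩ := hE e he
    obtain ⟨⟨R', hR'⟩, h1', h2', hlt'⟩ := hE e' he'
    have hP : e.1 = e'.1 := (hL j hj.1.2).point_unique (hL a ha) hj.1.1 hj.2 h1 hj'.2 h1'
    refine Prod.ext hP ?_
    rw [← hP] at hR' hlt'
    symm
    refine hR.eq_of_ray hL (s := (g e'.2 - g e.1) / (g e.2 - g e.1))
      (div_pos (by linarith) (by linarith)) hR' ?_
    rw [hg _ h1 _ h2', hg _ h1 _ h2, smul_smul, div_mul_cancel₀ _ (by linarith)]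
  rw [← Finset.card_biUnion hdisj]
  -- No edge starts at the furthest endpoint, yet a line j other than a passes through it as a side
  -- of its triangle. Discarding a and j leaves n - 2.
  obtain ⟨m, hm, hmax⟩ := E.exists_max_image (fun e => g e.2) hne
  obtain ⟨⟨R, hR⟩, h1, h2, hlt⟩ := hE m hm
  obtain ⟨j, hj, hQj, hRj⟩ := hR.line₁
  have hja : j ≠ a := by
    rintro rfl
    exact hR.ne (((hL _ ha).mem_iff h1 h2 hR.ne₁₂ _).1 hRj)
  have hsub : (E.biUnion fun e => (L.erase a).filter (e.1 ∈ ·)) ⊆ (L.erase a).erase j := by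
    intro k hk
    simp only [Finset.mem_biUnion, Finset.mem_filter] at hk
    obtain ⟨e, he, hk, hek⟩ := hk
    refine Finset.mem_erase.2 ⟨?_, hk⟩
    rintro rfl
    obtain ⟨-, h1', h2', hlt'⟩ := hE e he
    have : e.1 = m.2 := (hL _ hj).point_unique (hL a ha) hja hek h1' hQj h2
    have := hmax e he
    simp_all
    linarith
  refine (Finset.card_le_card hsub).trans ?_
  rw [Finset.card_erase_of_mem (Finset.mem_erase.2 ⟨hja, hj⟩), Finset.card_erase_of_mem ha]
  omega

lemma sum_card_line_le [DecidableEq (AffineSubspace ℝ Plane)]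
    [∀ P : Plane, DecidablePred fun j : AffineSubspace ℝ Plane => P ∈ j]
    (hL : ∀ a ∈ L, IsLine a) (E : Finset (Plane × Plane))
    {a : AffineSubspace ℝ Plane} (ha : a ∈ L)
    (hE : ∀ e ∈ E, (∃ R, IsMinTri L e.1 e.2 R) ∧ e.1 ∈ a ∧ e.2 ∈ a) :
    ∑ e ∈ E, ((L.erase a).filter (e.1 ∈ ·)).card ≤ 2 * (L.card - 2) := by
  classical
  obtain ⟨X, hX, Y, hY, hXY⟩ := (hL a ha).exists_ne
  have hcoord : ∀ Z : Plane, ∃ t : ℝ, Z ∈ a → Z = X + t • (Y - X) := by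
    intro Z
    by_cases hZ : Z ∈ a
    · obtain ⟨t, ht⟩ := (cross_eq_zero_iff hXY).1 (((hL a ha).mem_iff hX hY hXY Z).1 hZ)
      exact ⟨t, fun _ => ht⟩
    · exact ⟨0, fun h => absurd h hZ⟩
  choose g hg using hcoord
  have hg' : ∀ Z ∈ a, ∀ W ∈ a, W - Z = (g W - g Z) • (Y - X) := by
    intro Z hZ W hW
    conv_lhs => rw [hg Z hZ, hg W hW]
    rw [sub_smul]; abel
  have h1 := sum_card_ray_le hL (E.filter fun e => g e.1 < g e.2) ha g (Y - X) hg' (by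
    intro e he
    obtain ⟨he, hlt⟩ := Finset.mem_filter.1 he
    exact ⟨(hE e he).1, (hE e he).2.1, (hE e he).2.2, hlt⟩)
  -- The edges in the opposite direction are handled by negating the coordinate.
  have h2 := sum_card_ray_le hL (E.filter fun e => ¬ g e.1 < g e.2) ha (fun Z => -g Z) (-(Y - X))
    (by
      intro Z hZ W hW
      rw [hg' Z hZ W hW, smul_neg, ← neg_smul]; congr 1; ring) (by
    intro e he
    obtain ⟨he, hlt⟩ := Finset.mem_filter.1 he
    obtain ⟨⟨R, hR⟩, ha1, ha2⟩ := hE e he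
    refine ⟨⟨R, hR⟩, ha1, ha2, ?_⟩
    rcases lt_or_eq_of_le (not_lt.1 hlt) with h | h
    · exact neg_lt_neg h
    · refine absurd ?_ hR.ne₁₂
      rw [hg _ ha1, hg _ ha2, h])
  rw [← Finset.sum_filter_add_sum_filter_not E fun e => g e.1 < g e.2]
  omega

lemma IsMinTriFamily.three_mul_card_le_mul (hL : ∀ a ∈ L, IsLine a)
    {F : Finset (Finset Plane)} (hF : IsMinTriFamily L F) :
    3 * F.card ≤ L.card * (L.card - 2) := by
  classical
  set E := F.biUnion Finset.offDiag with hEdef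
  have hE : ∀ e ∈ E, ∃ R, IsMinTri L e.1 e.2 R := by
    intro e he
    obtain ⟨S, hS, heS⟩ := Finset.mem_biUnion.1 he
    obtain ⟨h1, h2, h3⟩ := Finset.mem_offDiag.1 heS
    obtain ⟨R, -, hR⟩ := hF.exists_third hS h1 h2 h3
    exact ⟨R, hR⟩
  have key : ∑ e ∈ E, (lineDegree L e.1 - 1) ≤ L.card * (2 * (L.card - 2)) := by
    calc ∑ e ∈ E, (lineDegree L e.1 - 1)
        ≤ ∑ e ∈ E, ∑ a ∈ L.filter (fun a => e.1 ∈ a ∧ e.2 ∈ a),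
            ((L.erase a).filter (e.1 ∈ ·)).card := by
          apply Finset.sum_le_sum
          intro e he
          obtain ⟨R, hR⟩ := hE e he
          obtain ⟨a, ha, h1, h2⟩ := hR.line₃
          -- The lines through the start other than the one carrying the edge number exactly d - 1,
          -- so a single term of the inner sum suffices.
          refine le_trans ?_ (Finset.single_le_sum (fun _ _ => Nat.zero_le _)
            (Finset.mem_filter.2 ⟨ha, h1, h2⟩))
          rw [Finset.filter_erase, Finset.card_erase_of_mem (Finset.mem_filter.2 ⟨ha, h1⟩)]
          unfold lineDegree
          exact le_of_eq (by congr!)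
      _ = ∑ a ∈ L, ∑ e ∈ E.filter (fun e => e.1 ∈ a ∧ e.2 ∈ a),
            ((L.erase a).filter (e.1 ∈ ·)).card := by
          apply Finset.sum_comm'
          intro e a
          simp only [Finset.mem_filter]
          tauto
      _ ≤ ∑ a ∈ L, 2 * (L.card - 2) := by
          apply Finset.sum_le_sum
          intro a ha
          apply sum_card_line_le hL _ ha
          intro e he
          obtain ⟨he, h⟩ := Finset.mem_filter.1 he
          exact ⟨hE e he, h⟩
      _ = _ := by simp
  have h3 := hF.three_mul_card_le hL
  have h4 : ∑ e ∈ E, ((lineDegree L e.1 : ℝ) - 1) / 2 =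
      ((∑ e ∈ E, (lineDegree L e.1 - 1) : ℕ) : ℝ) / 2 := by
    rw [← Finset.sum_div, Nat.cast_sum]
    congr 1
    apply Finset.sum_congr rfl
    intro e he
    obtain ⟨R, hR⟩ := hE e he
    have := hR.two_le_lineDegree hL
    rw [Nat.cast_sub (by omega), Nat.cast_one]
  rw [h4] at h3
  have h5 : (3 * F.card : ℝ) ≤ L.card * (L.card - 2 : ℕ) := by
    have : ((∑ e ∈ E, (lineDegree L e.1 - 1) : ℕ) : ℝ) ≤ ((L.card * (2 * (L.card - 2)) : ℕ) : ℝ) := by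
      exact_mod_cast key
    push_cast at this ⊢
    push_cast at h3
    linarith
  exact_mod_cast h5

/-! ### Triples of lines versus triples of vertices. -/

open Classical in
/-- The sides of the triangle `P Q R`, as lines. -/
noncomputable def sideLines (P Q R : Plane) : Finset (AffineSubspace ℝ Plane) :=
  {line[ℝ, Q, R], line[ℝ, P, R], line[ℝ, P, Q]}

lemma ne_of_cross_ne_zero (h : cross P Q R ≠ 0) : P ≠ Q ∧ P ≠ R ∧ Q ≠ R := by
  refine ⟨?_, ?_, ?_⟩ <;> rintro rfl <;> exact h (by unfold cross; ring)

lemma mem_sideLines {a : AffineSubspace ℝ Plane} :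
    a ∈ sideLines P Q R ↔ a = line[ℝ, Q, R] ∨ a = line[ℝ, P, R] ∨ a = line[ℝ, P, Q] := by
  simp [sideLines]

lemma mem_sideLines_iff_exists (h : cross P Q R ≠ 0) (a : AffineSubspace ℝ Plane) :
    a ∈ sideLines P Q R ↔ ∃ X ∈ ({P, Q, R} : Set Plane), ∃ Y ∈ ({P, Q, R} : Set Plane),
      X ≠ Y ∧ a = line[ℝ, X, Y] := by
  obtain ⟨h1, h2, h3⟩ := ne_of_cross_ne_zero h
  rw [mem_sideLines]
  constructor
  · rintro (rfl | rfl | rfl)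
    · exact ⟨Q, by simp, R, by simp, h3, rfl⟩
    · exact ⟨P, by simp, R, by simp, h2, rfl⟩
    · exact ⟨P, by simp, Q, by simp, h1, rfl⟩
  · rintro ⟨X, hX, Y, hY, hXY, rfl⟩
    simp only [Set.mem_insert_iff, Set.mem_singleton_iff] at hX hY
    rcases hX with rfl | rfl | rfl <;> rcases hY with rfl | rfl | rfl <;>
      simp_all [Set.pair_comm]

lemma notMem_line (h : cross P Q R ≠ 0) :
    P ∉ line[ℝ, Q, R] ∧ Q ∉ line[ℝ, P, R] ∧ R ∉ line[ℝ, P, Q] := by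
  obtain ⟨h1, h2, h3⟩ := ne_of_cross_ne_zero h
  refine ⟨?_, ?_, ?_⟩
  · rw [mem_affineSpan_pair_iff_cross h3, cross_rotate]; exact h
  · rw [mem_affineSpan_pair_iff_cross h2, ← cross_rotate, cross_swap, cross_rotate]
    simpa using h
  · rw [mem_affineSpan_pair_iff_cross h1]; exact h

lemma sideLines_ne (h : cross P Q R ≠ 0) :
    line[ℝ, Q, R] ≠ line[ℝ, P, R] ∧ line[ℝ, Q, R] ≠ line[ℝ, P, Q] ∧
      line[ℝ, P, R] ≠ line[ℝ, P, Q] := by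
  obtain ⟨h1, h2, h3⟩ := notMem_line h
  refine ⟨?_, ?_, ?_⟩ <;> intro e
  · exact h1 (e ▸ left_mem_affineSpan_pair ℝ P R)
  · exact h1 (e ▸ left_mem_affineSpan_pair ℝ P Q)
  · exact h2 (e ▸ right_mem_affineSpan_pair ℝ P Q)

lemma triangleVertices_sideLines (h : cross P Q R ≠ 0) :
    triangleVertices (sideLines P Q R) = {P, Q, R} := by
  obtain ⟨h1, h2, h3⟩ := ne_of_cross_ne_zero h
  obtain ⟨n1, n2, n3⟩ := sideLines_ne h
  have lPQ : P ∈ line[ℝ, P, Q] := left_mem_affineSpan_pair ℝ P Q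
  have rPQ : Q ∈ line[ℝ, P, Q] := right_mem_affineSpan_pair ℝ P Q
  have lPR : P ∈ line[ℝ, P, R] := left_mem_affineSpan_pair ℝ P R
  have rPR : R ∈ line[ℝ, P, R] := right_mem_affineSpan_pair ℝ P R
  have lQR : Q ∈ line[ℝ, Q, R] := left_mem_affineSpan_pair ℝ Q R
  have rQR : R ∈ line[ℝ, Q, R] := right_mem_affineSpan_pair ℝ Q R
  have i1 := isLine_affineSpan_pair h1
  have i2 := isLine_affineSpan_pair h2
  have i3 := isLine_affineSpan_pair h3
  ext X
  simp only [triangleVertices, Set.mem_ofPred_eq, Set.mem_insert_iff, Set.mem_singleton_iff]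
  constructor
  · rintro ⟨a, ha, b, hb, hab, hXa, hXb⟩
    rw [mem_sideLines] at ha hb
    rcases ha with rfl | rfl | rfl <;> rcases hb with rfl | rfl | rfl
    · exact absurd rfl hab
    · exact Or.inr (Or.inr (i3.point_unique i2 n1 hXa hXb rQR rPR))
    · exact Or.inr (Or.inl (i3.point_unique i1 n2 hXa hXb lQR rPQ))
    · exact Or.inr (Or.inr (i3.point_unique i2 n1 hXb hXa rQR rPR))
    · exact absurd rfl hab
    · exact Or.inl (i2.point_unique i1 n3 hXa hXb lPR lPQ)
    · exact Or.inr (Or.inl (i3.point_unique i1 n2 hXb hXa lQR rPQ))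
    · exact Or.inl (i2.point_unique i1 n3 hXb hXa lPR lPQ)
    · exact absurd rfl hab
  · rintro (rfl | rfl | rfl)
    · exact ⟨_, by simp [mem_sideLines], _, by simp [mem_sideLines], n3, lPR, lPQ⟩
    · exact ⟨_, by simp [mem_sideLines], _, by simp [mem_sideLines], n2, lQR, rPQ⟩
    · exact ⟨_, by simp [mem_sideLines], _, by simp [mem_sideLines], n1, rQR, rPR⟩

lemma triangleArea_sideLines (h : cross P Q R ≠ 0) :
    triangleArea (sideLines P Q R) =
      (volume : Measure Plane).real stdTriangle * |cross P Q R| := by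
  rw [triangleArea, triangleVertices_sideLines h, volume_real_triangle]

lemma formsTriangle_sideLines (h : cross P Q R ≠ 0) : FormsTriangle (sideLines P Q R) := by
  classical
  obtain ⟨h1, h2, h3⟩ := ne_of_cross_ne_zero h
  obtain ⟨n1, n2, n3⟩ := sideLines_ne h
  refine ⟨Finset.card_eq_three.2 ⟨_, _, _, n1, n2, n3, by unfold sideLines; congr!⟩, ?_, ?_, ?_⟩
  · intro a ha
    rcases mem_sideLines.1 ha with rfl | rfl | rfl
    exacts [isLine_affineSpan_pair h3, isLine_affineSpan_pair h2, isLine_affineSpan_pair h1]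
  · intro a ha b hb hab
    rcases mem_sideLines.1 ha with rfl | rfl | rfl <;>
      rcases mem_sideLines.1 hb with rfl | rfl | rfl
    · exact absurd rfl hab
    · exact ⟨R, right_mem_affineSpan_pair ℝ _ _, right_mem_affineSpan_pair ℝ _ _⟩
    · exact ⟨Q, left_mem_affineSpan_pair ℝ _ _, right_mem_affineSpan_pair ℝ _ _⟩
    · exact ⟨R, right_mem_affineSpan_pair ℝ _ _, right_mem_affineSpan_pair ℝ _ _⟩
    · exact absurd rfl hab
    · exact ⟨P, left_mem_affineSpan_pair ℝ _ _, left_mem_affineSpan_pair ℝ _ _⟩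
    · exact ⟨Q, right_mem_affineSpan_pair ℝ _ _, left_mem_affineSpan_pair ℝ _ _⟩
    · exact ⟨P, left_mem_affineSpan_pair ℝ _ _, left_mem_affineSpan_pair ℝ _ _⟩
    · exact absurd rfl hab
  · rintro ⟨X, hX⟩
    have e1 := hX _ (mem_sideLines.2 (Or.inl rfl))
    have e2 := hX _ (mem_sideLines.2 (Or.inr (Or.inl rfl)))
    have e3 := hX _ (mem_sideLines.2 (Or.inr (Or.inr rfl)))
    have hXR := (isLine_affineSpan_pair h3).point_unique (isLine_affineSpan_pair h2) n1 e1 e2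
      (right_mem_affineSpan_pair ℝ _ _) (right_mem_affineSpan_pair ℝ _ _)
    rw [hXR] at e3
    exact (notMem_line h).2.2 e3

lemma FormsTriangle.exists_eq_sideLines {T : Finset (AffineSubspace ℝ Plane)}
    (hT : FormsTriangle T) : ∃ P Q R, cross P Q R ≠ 0 ∧ T = sideLines P Q R := by
  classical
  obtain ⟨hcard, hline, hmeet, hcommon⟩ := hT
  obtain ⟨a, b, c, hab, hac, hbc, rfl⟩ := Finset.card_eq_three.1 hcard
  have ha : IsLine a := hline a (by simp)
  have hb : IsLine b := hline b (by simp)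
  have hc : IsLine c := hline c (by simp)
  obtain ⟨R, hRa, hRb⟩ := hmeet a (by simp) b (by simp) hab
  obtain ⟨Q, hQa, hQc⟩ := hmeet a (by simp) c (by simp) hac
  obtain ⟨P, hPb, hPc⟩ := hmeet b (by simp) c (by simp) hbc
  have hRc : R ∉ c := fun h => hcommon ⟨R, by simp [hRa, hRb, h]⟩
  have hQb : Q ∉ b := fun h => hcommon ⟨Q, by simp [hQa, hQc, h]⟩
  have hPQ : P ≠ Q := fun h => hQb (h ▸ hPb)
  have hPR : P ≠ R := fun h => hRc (h ▸ hPc)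
  have hQR : Q ≠ R := fun h => hRc (h ▸ hQc)
  refine ⟨P, Q, R, fun h => hRc ((hc.mem_iff hPc hQc hPQ R).2 h), ?_⟩
  rw [ha.eq_affineSpan hQa hRa hQR, hb.eq_affineSpan hPb hRb hPR, hc.eq_affineSpan hPc hQc hPQ]
  unfold sideLines
  congr!

lemma mem_trianglesOf {T : Finset (AffineSubspace ℝ Plane)} :
    T ∈ trianglesOf L ↔ T ⊆ L ∧ FormsTriangle T := by
  classical
  simp only [trianglesOf, Finset.mem_filter, Finset.mem_powersetCard]
  constructor
  · rintro ⟨⟨h1, -⟩, h2⟩; exact ⟨h1, h2⟩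
  · rintro ⟨h1, h2⟩; exact ⟨⟨h1, h2.1⟩, h2⟩

lemma sideLines_mem_trianglesOf (hL : ∀ a ∈ L, IsLine a) (h : cross P Q R ≠ 0) :
    sideLines P Q R ∈ trianglesOf L ↔ IsTri L P Q R := by
  obtain ⟨h1, h2, h3⟩ := ne_of_cross_ne_zero h
  rw [mem_trianglesOf]
  constructor
  · rintro ⟨hsub, -⟩
    exact ⟨h,
      ⟨_, hsub (mem_sideLines.2 (Or.inl rfl)), left_mem_affineSpan_pair ℝ _ _,
        right_mem_affineSpan_pair ℝ _ _⟩,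
      ⟨_, hsub (mem_sideLines.2 (Or.inr (Or.inl rfl))), left_mem_affineSpan_pair ℝ _ _,
        right_mem_affineSpan_pair ℝ _ _⟩,
      ⟨_, hsub (mem_sideLines.2 (Or.inr (Or.inr rfl))), left_mem_affineSpan_pair ℝ _ _,
        right_mem_affineSpan_pair ℝ _ _⟩⟩
  · rintro ⟨-, ⟨a, ha, hQa, hRa⟩, ⟨b, hb, hPb, hRb⟩, c, hc, hPc, hQc⟩
    refine ⟨?_, formsTriangle_sideLines h⟩
    intro x hx
    rcases mem_sideLines.1 hx with rfl | rfl | rfl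
    · rwa [← (hL a ha).eq_affineSpan hQa hRa h3]
    · rwa [← (hL b hb).eq_affineSpan hPb hRb h2]
    · rwa [← (hL c hc).eq_affineSpan hPc hQc h1]

lemma mem_minAreaTriangles {T : Finset (AffineSubspace ℝ Plane)} :
    T ∈ minAreaTriangles L ↔ T ∈ trianglesOf L ∧
      ∀ T' ∈ trianglesOf L, triangleArea T ≤ triangleArea T' := by
  classical
  simp [minAreaTriangles]

/-- This bridge replaces Lebesgue area of triples of lines by the absolute signed area of vertices;
the positive constant cancels from the comparison. -/
lemma sideLines_mem_minAreaTriangles (hL : ∀ a ∈ L, IsLine a) (h : cross P Q R ≠ 0) :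
    sideLines P Q R ∈ minAreaTriangles L ↔ IsMinTri L P Q R := by
  rw [mem_minAreaTriangles, sideLines_mem_trianglesOf hL h]
  constructor
  · rintro ⟨h1, h2⟩
    refine ⟨h1, fun X Y Z hXYZ => ?_⟩
    have := h2 _ ((sideLines_mem_trianglesOf hL hXYZ.ne).2 hXYZ)
    rw [triangleArea_sideLines h, triangleArea_sideLines hXYZ.ne] at this
    exact le_of_mul_le_mul_left this stdTriangle_pos
  · intro hm
    refine ⟨hm.toIsTri, fun T' hT' => ?_⟩
    obtain ⟨X, Y, Z, hXYZ, rfl⟩ := (mem_trianglesOf.1 hT').2.exists_eq_sideLines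
    rw [triangleArea_sideLines h, triangleArea_sideLines hXYZ]
    exact mul_le_mul_of_nonneg_left (hm.min _ _ _ ((sideLines_mem_trianglesOf hL hXYZ).1 hT'))
      stdTriangle_pos.le

open Classical in
/-- The vertices of a triangle as a finite set. -/
noncomputable def vertexFinset (T : Finset (AffineSubspace ℝ Plane)) : Finset Plane :=
  if h : (triangleVertices T).Finite then h.toFinset else ∅

lemma mem_vertexFinset_sideLines (h : cross P Q R ≠ 0) (X : Plane) :
    X ∈ vertexFinset (sideLines P Q R) ↔ X = P ∨ X = Q ∨ X = R := by
  have hv := triangleVertices_sideLines h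
  have hfin : (triangleVertices (sideLines P Q R)).Finite := by rw [hv]; exact Set.toFinite _
  rw [vertexFinset, dif_pos hfin, Set.Finite.mem_toFinset, hv]
  simp

lemma three_mul_card_minAreaTriangles_le (hL : ∀ a ∈ L, IsLine a) :
    3 * (minAreaTriangles L).card ≤ L.card * (L.card - 2) := by
  classical
  -- The sides are the joins of distinct vertices, so the vertex set determines the triple of lines.
  have hinj : Set.InjOn vertexFinset (minAreaTriangles L : Set (Finset (AffineSubspace ℝ Plane))) := by
    intro T hT T' hT' hv
    obtain ⟨P, Q, R, h, rfl⟩ :=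
      (mem_trianglesOf.1 (mem_minAreaTriangles.1 hT).1).2.exists_eq_sideLines
    obtain ⟨P', Q', R', h', rfl⟩ :=
      (mem_trianglesOf.1 (mem_minAreaTriangles.1 hT').1).2.exists_eq_sideLines
    have hset : ({P, Q, R} : Set Plane) = {P', Q', R'} := by
      ext X
      have := mem_vertexFinset_sideLines h X
      rw [hv, mem_vertexFinset_sideLines h' X] at this
      simpa using this.symm
    ext a
    rw [mem_sideLines_iff_exists h, mem_sideLines_iff_exists h', hset]
  rw [← Finset.card_image_of_injOn hinj]
  apply IsMinTriFamily.three_mul_card_le_mul hL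
  intro S hS
  obtain ⟨T, hT, rfl⟩ := Finset.mem_image.1 hS
  obtain ⟨P, Q, R, h, rfl⟩ :=
    (mem_trianglesOf.1 (mem_minAreaTriangles.1 hT).1).2.exists_eq_sideLines
  exact ⟨P, Q, R, mem_vertexFinset_sideLines h, (sideLines_mem_minAreaTriangles hL h).1 hT⟩

/-! ### The trihexagonal arrangement. -/

/-- The line `x = t`. -/
noncomputable def vertLine (t : ℝ) : AffineSubspace ℝ Plane := line[ℝ, !₂[t, 0], !₂[t, 1]]

/-- The line `y = t`. -/
noncomputable def horizLine (t : ℝ) : AffineSubspace ℝ Plane := line[ℝ, !₂[0, t], !₂[1, t]]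

/-- The line `x + y = t`. -/
noncomputable def diagLine (t : ℝ) : AffineSubspace ℝ Plane := line[ℝ, !₂[t, 0], !₂[t - 1, 1]]

lemma vec_ne_of_left {a b c d : ℝ} (h : a ≠ c) : (!₂[a, b] : Plane) ≠ !₂[c, d] := by
  intro e
  exact h (by simpa using congrArg (fun X : Plane => X 0) e)

lemma vec_ne_of_right {a b c d : ℝ} (h : b ≠ d) : (!₂[a, b] : Plane) ≠ !₂[c, d] := by
  intro e
  exact h (by simpa using congrArg (fun X : Plane => X 1) e)

lemma isLine_vertLine (t : ℝ) : IsLine (vertLine t) :=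
  isLine_affineSpan_pair (vec_ne_of_right zero_ne_one)

lemma isLine_horizLine (t : ℝ) : IsLine (horizLine t) :=
  isLine_affineSpan_pair (vec_ne_of_left zero_ne_one)

lemma isLine_diagLine (t : ℝ) : IsLine (diagLine t) :=
  isLine_affineSpan_pair (vec_ne_of_right zero_ne_one)

lemma mem_vertLine {t : ℝ} {X : Plane} : X ∈ vertLine t ↔ X 0 = t := by
  rw [vertLine, mem_affineSpan_pair_iff_cross (vec_ne_of_right zero_ne_one)]
  simp [cross]
  constructor <;> intro h <;> linarith

lemma mem_horizLine {t : ℝ} {X : Plane} : X ∈ horizLine t ↔ X 1 = t := by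
  rw [horizLine, mem_affineSpan_pair_iff_cross (vec_ne_of_left zero_ne_one)]
  simp [cross]
  constructor <;> intro h <;> linarith

lemma mem_diagLine {t : ℝ} {X : Plane} : X ∈ diagLine t ↔ X 0 + X 1 = t := by
  rw [diagLine, mem_affineSpan_pair_iff_cross (vec_ne_of_right zero_ne_one)]
  simp [cross]
  constructor <;> intro h <;> linarith

lemma vertLine_injective : Function.Injective vertLine := by
  intro s t h
  have : (!₂[s, 0] : Plane) ∈ vertLine s := mem_vertLine.2 (by simp)
  rw [h, mem_vertLine] at this
  simpa using this

lemma horizLine_injective : Function.Injective horizLine := by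
  intro s t h
  have : (!₂[0, s] : Plane) ∈ horizLine s := mem_horizLine.2 (by simp)
  rw [h, mem_horizLine] at this
  simpa using this

lemma diagLine_injective : Function.Injective diagLine := by
  intro s t h
  have : (!₂[s, 0] : Plane) ∈ diagLine s := mem_diagLine.2 (by simp)
  rw [h, mem_diagLine] at this
  simpa using this

lemma vertLine_ne_horizLine (s t : ℝ) : vertLine s ≠ horizLine t := by
  intro h
  have : (!₂[s, t + 1] : Plane) ∈ vertLine s := mem_vertLine.2 (by simp)
  rw [h, mem_horizLine] at this
  simp at this

lemma vertLine_ne_diagLine (s t : ℝ) : vertLine s ≠ diagLine t := by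
  intro h
  have : (!₂[s, t - s + 1] : Plane) ∈ vertLine s := mem_vertLine.2 (by simp)
  rw [h, mem_diagLine] at this
  simp at this
  linarith

lemma horizLine_ne_diagLine (s t : ℝ) : horizLine s ≠ diagLine t := by
  intro h
  have : (!₂[t - s + 1, s] : Plane) ∈ horizLine s := mem_horizLine.2 (by simp)
  rw [h, mem_diagLine] at this
  simp at this
  linarith

open Classical in
/-- Lines of the trihexagonal tiling: `p` vertical and `p` horizontal lines with integer
coordinates and `r` diagonal lines halfway between the lattice points. -/
noncomputable def tilingLines (p r s : ℕ) : Finset (AffineSubspace ℝ Plane) :=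
  ((Finset.range p).image fun i : ℕ => vertLine i) ∪
    (((Finset.range p).image fun j : ℕ => horizLine j) ∪
      (Finset.range r).image fun k : ℕ => diagLine (k + s + 1 / 2))

lemma mem_tilingLines {p r s : ℕ} {a : AffineSubspace ℝ Plane} :
    a ∈ tilingLines p r s ↔ (∃ i < p, vertLine (i : ℕ) = a) ∨ (∃ j < p, horizLine (j : ℕ) = a) ∨
      ∃ k < r, diagLine ((k : ℕ) + s + 1 / 2) = a := by
  simp [tilingLines]

lemma isLine_of_mem_tilingLines {p r s : ℕ} {a : AffineSubspace ℝ Plane}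
    (ha : a ∈ tilingLines p r s) : IsLine a := by
  rcases mem_tilingLines.1 ha with ⟨i, -, rfl⟩ | ⟨j, -, rfl⟩ | ⟨k, -, rfl⟩
  exacts [isLine_vertLine _, isLine_horizLine _, isLine_diagLine _]

lemma card_tilingLines (p r s : ℕ) : (tilingLines p r s).card = 2 * p + r := by
  classical
  have hinj : Function.Injective fun k : ℕ => diagLine (k + s + 1 / 2) := by
    intro k k' h
    have := diagLine_injective h
    have : (k : ℝ) = k' := by linarith
    exact_mod_cast this
  unfold tilingLines
  rw [Finset.card_union_of_disjoint, Finset.card_union_of_disjoint,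
    Finset.card_image_of_injective (f := fun i : ℕ => vertLine i) _
      (vertLine_injective.comp Nat.cast_injective),
    Finset.card_image_of_injective (f := fun j : ℕ => horizLine j) _
      (horizLine_injective.comp Nat.cast_injective),
    Finset.card_image_of_injective _ hinj]
  · simp; ring
  · rw [Finset.disjoint_left]
    intro a ha hb
    simp only [Finset.mem_image] at ha hb
    obtain ⟨i, -, rfl⟩ := ha
    obtain ⟨k, -, h⟩ := hb
    exact horizLine_ne_diagLine _ _ h.symm
  · rw [Finset.disjoint_left]
    intro a ha hb
    simp only [Finset.mem_image, Finset.mem_union] at ha hb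
    obtain ⟨i, -, rfl⟩ := ha
    rcases hb with ⟨k, -, h⟩ | ⟨k, -, h⟩
    · exact vertLine_ne_horizLine _ _ h.symm
    · exact vertLine_ne_diagLine _ _ h.symm

/-- A half-integer is at distance at least 1/2 from 0; this is what the shift of the diagonals by
1/2 buys. -/
lemma quarter_le_sq (i j k s : ℕ) : (1 / 4 : ℝ) ≤ ((k : ℝ) + s + 1 / 2 - i - j) ^ 2 := by
  rcases le_or_gt (i + j) (k + s) with h | h
  · have : ((i : ℝ) + j) ≤ k + s := by exact_mod_cast h
    nlinarith
  · have : ((k : ℝ) + s + 1) ≤ i + j := by exact_mod_cast h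
    nlinarith

lemma cross_eq_zero_of_fst_eq {P Q R : Plane} (h₁ : P 0 = Q 0) (h₂ : P 0 = R 0) :
    cross P Q R = 0 := by
  rw [cross, ← h₁, ← h₂]; ring

lemma cross_eq_zero_of_snd_eq {P Q R : Plane} (h₁ : P 1 = Q 1) (h₂ : P 1 = R 1) :
    cross P Q R = 0 := by
  rw [cross, ← h₁, ← h₂]; ring

lemma cross_eq_zero_of_add_eq {P Q R : Plane} (h₁ : P 0 + P 1 = Q 0 + Q 1)
    (h₂ : P 0 + P 1 = R 0 + R 1) : cross P Q R = 0 := by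
  rw [cross, show Q 1 = P 0 + P 1 - Q 0 by linarith, show R 1 = P 0 + P 1 - R 0 by linarith]; ring

/-- The triangle has a right angle at R and both legs of length |t - i - j|. -/
lemma abs_cross_eq_sq {P Q R : Plane} {i j t : ℝ} (h₁ : Q 0 = i) (h₂ : R 0 = i) (h₃ : P 1 = j)
    (h₄ : R 1 = j) (h₅ : P 0 + P 1 = t) (h₆ : Q 0 + Q 1 = t) :
    |cross P Q R| = (t - i - j) ^ 2 := by
  rw [← abs_of_nonneg (sq_nonneg (t - i - j))]
  congr 1
  rw [cross, show P 0 = t - j by linarith, show Q 1 = t - i by linarith, h₁, h₂, h₃, h₄]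
  ring

lemma abs_cross_swap (P Q R : Plane) : |cross P Q R| = |cross Q P R| := by
  rw [cross_swap, abs_neg]

lemma abs_cross_rotate (P Q R : Plane) : |cross P Q R| = |cross Q R P| := by
  rw [cross_rotate P Q R]

/-- Two sides from the same parallel family share a vertex, so they coincide and the triangle
degenerates. The six remaining cases are the orderings of one line from each family. -/
lemma quarter_le_abs_cross {p r s : ℕ} {P Q R : Plane} (h : IsTri (tilingLines p r s) P Q R) :
    1 / 4 ≤ |cross P Q R| := by
  obtain ⟨hne, ⟨a, ha, hQa, hRa⟩, ⟨b, hb, hPb, hRb⟩, c, hc, hPc, hQc⟩ := h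
  suffices H : cross P Q R = 0 ∨
      ∃ i j k : ℕ, |cross P Q R| = ((k : ℝ) + s + 1 / 2 - i - j) ^ 2 by
    rcases H with H | ⟨i, j, k, H⟩
    · exact absurd H hne
    · rw [H]
      exact quarter_le_sq i j k s
  rcases mem_tilingLines.1 ha with ⟨i, -, rfl⟩ | ⟨i, -, rfl⟩ | ⟨i, -, rfl⟩ <;>
  rcases mem_tilingLines.1 hb with ⟨j, -, rfl⟩ | ⟨j, -, rfl⟩ | ⟨j, -, rfl⟩ <;>
  rcases mem_tilingLines.1 hc with ⟨k, -, rfl⟩ | ⟨k, -, rfl⟩ | ⟨k, -, rfl⟩ <;>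
  simp only [mem_vertLine, mem_horizLine, mem_diagLine] at hQa hRa hPb hRb hPc hQc <;>
  first
    | exact Or.inl (cross_eq_zero_of_fst_eq (by linarith) (by linarith))
    | exact Or.inl (cross_eq_zero_of_snd_eq (by linarith) (by linarith))
    | exact Or.inl (cross_eq_zero_of_add_eq (by linarith) (by linarith))
    | skip
  · exact Or.inr ⟨i, j, k, abs_cross_eq_sq hQa hRa hPb hRb hPc hQc⟩
  · exact Or.inr ⟨i, k, j, by rw [abs_cross_swap, abs_cross_rotate]; exact abs_cross_eq_sq hRa hQa hPc hQc hPb hRb⟩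
  · exact Or.inr ⟨j, i, k, by rw [abs_cross_swap]; exact abs_cross_eq_sq hPb hRb hQa hRa hQc hPc⟩
  · exact Or.inr ⟨k, i, j, by rw [abs_cross_rotate, abs_cross_rotate]; exact abs_cross_eq_sq hPc hQc hRa hQa hRb hPb⟩
  · exact Or.inr ⟨j, k, i, by rw [abs_cross_rotate]; exact abs_cross_eq_sq hRb hPb hQc hPc hQa hRa⟩
  · exact Or.inr ⟨k, j, i, by rw [abs_cross_rotate, abs_cross_swap]; exact abs_cross_eq_sq hQc hPc hRb hPb hRa hQa⟩

open Classical in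
/-- The triangle cut out by `x = i`, `y = j` and `x + y = t`. -/
lemma sideLines_grid {i j t : ℝ} (h : t - i - j ≠ 0) :
    sideLines !₂[t - j, j] !₂[i, t - i] !₂[i, j] =
      {vertLine i, horizLine j, diagLine t} := by
  have h1 : (!₂[i, t - i] : Plane) ≠ !₂[i, j] :=
    vec_ne_of_right fun e => h (by linarith)
  have h2 : (!₂[t - j, j] : Plane) ≠ !₂[i, j] :=
    vec_ne_of_left fun e => h (by linarith)
  have h3 : (!₂[t - j, j] : Plane) ≠ !₂[i, t - i] :=
    vec_ne_of_left fun e => h (by linarith)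
  rw [sideLines, (isLine_vertLine i).eq_affineSpan (mem_vertLine.2 (by simp))
      (mem_vertLine.2 (by simp)) h1,
    (isLine_horizLine j).eq_affineSpan (mem_horizLine.2 (by simp)) (mem_horizLine.2 (by simp)) h2,
    (isLine_diagLine t).eq_affineSpan (mem_diagLine.2 (by simp)) (mem_diagLine.2 (by simp)) h3]

lemma grid_mem_minAreaTriangles {p r s i j k : ℕ} (hi : i < p) (hj : j < p) (hk : k < r)
    (h : i + j = k + s ∨ i + j = k + s + 1) :
    sideLines !₂[(k : ℝ) + s + 1 / 2 - j, (j : ℝ)] !₂[(i : ℝ), (k : ℝ) + s + 1 / 2 - i] !₂[(i : ℝ), (j : ℝ)]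
      ∈ minAreaTriangles (tilingLines p r s) := by
  have hsq : ((k : ℝ) + s + 1 / 2 - i - j) ^ 2 = 1 / 4 := by
    rcases h with h | h
    · have : (i : ℝ) + j = k + s := by exact_mod_cast h
      rw [show (k : ℝ) + s + 1 / 2 - i - j = 1 / 2 by linarith]; norm_num
    · have : (i : ℝ) + j = k + s + 1 := by exact_mod_cast h
      rw [show (k : ℝ) + s + 1 / 2 - i - j = -(1 / 2) by linarith]; norm_num
  have habs : |cross !₂[(k : ℝ) + s + 1 / 2 - j, (j : ℝ)] !₂[(i : ℝ), (k : ℝ) + s + 1 / 2 - i]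
      !₂[(i : ℝ), (j : ℝ)]| = 1 / 4 := by
    rw [← hsq]
    apply abs_cross_eq_sq <;> simp
  have hne : cross !₂[(k : ℝ) + s + 1 / 2 - j, (j : ℝ)] !₂[(i : ℝ), (k : ℝ) + s + 1 / 2 - i]
      !₂[(i : ℝ), (j : ℝ)] ≠ 0 := by
    intro h0
    rw [h0] at habs
    norm_num at habs
  rw [sideLines_mem_minAreaTriangles (fun a ha => isLine_of_mem_tilingLines ha) hne]
  refine ⟨⟨hne, ?_, ?_, ?_⟩, fun X Y Z hXYZ => ?_⟩
  · exact ⟨_, mem_tilingLines.2 (Or.inl ⟨i, hi, rfl⟩), mem_vertLine.2 (by simp),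
      mem_vertLine.2 (by simp)⟩
  · exact ⟨_, mem_tilingLines.2 (Or.inr (Or.inl ⟨j, hj, rfl⟩)), mem_horizLine.2 (by simp),
      mem_horizLine.2 (by simp)⟩
  · exact ⟨_, mem_tilingLines.2 (Or.inr (Or.inr ⟨k, hk, rfl⟩)), mem_diagLine.2 (by simp),
      mem_diagLine.2 (by simp)⟩
  · rw [habs]
    exact quarter_le_abs_cross hXYZ

/-! ### Counting the small triangles. -/

/-- The triples indexing minimum-area triangles of `tilingLines p r s`. -/
def gridTriples (p r s : ℕ) : Finset (ℕ × ℕ × ℕ) :=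
  (Finset.range p ×ˢ Finset.range p ×ˢ Finset.range r).filter fun x =>
    x.1 + x.2.1 = x.2.2 + s ∨ x.1 + x.2.1 = x.2.2 + s + 1

lemma card_gridTriples_le (p r s : ℕ) :
    (gridTriples p r s).card ≤ (minAreaTriangles (tilingLines p r s)).card := by
  classical
  refine Finset.card_le_card_of_injOn (fun x => sideLines
    !₂[(x.2.2 : ℝ) + s + 1 / 2 - x.2.1, (x.2.1 : ℝ)] !₂[(x.1 : ℝ), (x.2.2 : ℝ) + s + 1 / 2 - x.1]
      !₂[(x.1 : ℝ), (x.2.1 : ℝ)]) ?_ ?_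
  · rintro ⟨i, j, k⟩ hx
    simp only [gridTriples, Finset.coe_filter, Finset.mem_product, Finset.mem_range,
      Set.mem_ofPred_eq] at hx
    exact grid_mem_minAreaTriangles hx.1.1 hx.1.2.1 hx.1.2.2 hx.2
  · have hne : ∀ i j k : ℕ, (k : ℝ) + s + 1 / 2 - i - j ≠ 0 := by
      intro i j k h0
      have := quarter_le_sq i j k s
      rw [h0] at this
      norm_num at this
    rintro ⟨i, j, k⟩ - ⟨i', j', k'⟩ - h
    simp only at h
    rw [sideLines_grid (hne i j k), sideLines_grid (hne i' j' k')] at h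
    have hv : vertLine i ∈ ({vertLine i', horizLine j', diagLine (k' + s + 1 / 2)} :
        Finset (AffineSubspace ℝ Plane)) := by rw [← h]; simp
    have hh : horizLine j ∈ ({vertLine i', horizLine j', diagLine (k' + s + 1 / 2)} :
        Finset (AffineSubspace ℝ Plane)) := by rw [← h]; simp
    have hd : diagLine (k + s + 1 / 2) ∈ ({vertLine i', horizLine j', diagLine (k' + s + 1 / 2)} :
        Finset (AffineSubspace ℝ Plane)) := by rw [← h]; simp
    simp only [Finset.mem_insert, Finset.mem_singleton, vertLine_ne_horizLine,
      vertLine_ne_diagLine, (vertLine_ne_horizLine _ _).symm, (vertLine_ne_diagLine _ _).symm,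
      horizLine_ne_diagLine, (horizLine_ne_diagLine _ _).symm, or_false, false_or,
      vertLine_injective.eq_iff, horizLine_injective.eq_iff, diagLine_injective.eq_iff,
      Nat.cast_inj, add_left_inj] at hv hh hd
    rw [hv, hh, hd]

/-- The corner lies in the union of the first m antidiagonals, whose sizes add up to a triangular
number. -/
lemma two_mul_card_lt_le (p m : ℕ) :
    2 * ((Finset.range p ×ˢ Finset.range p).filter fun x => x.1 + x.2 < m).card ≤ m * (m + 1) := by
  have hsub : ((Finset.range p ×ˢ Finset.range p).filter fun x => x.1 + x.2 < m) ⊆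
      (Finset.range m).biUnion Finset.HasAntidiagonal.antidiagonal := by
    intro x hx
    simp only [Finset.mem_filter] at hx
    exact Finset.mem_biUnion.2 ⟨x.1 + x.2, Finset.mem_range.2 hx.2, by simp⟩
  have h1 := (Finset.card_le_card hsub).trans Finset.card_biUnion_le
  simp only [Finset.Nat.card_antidiagonal] at h1
  have h2 : ∀ m : ℕ, 2 * ∑ t ∈ Finset.range m, (t + 1) = m * (m + 1) := by
    intro m
    induction m with
    | zero => simp
    | succ m ih => rw [Finset.sum_range_succ, mul_add, ih]; ring
  rw [← h2]
  omega

/-- The point reflection of the square takes the upper corner into the lower one. -/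
lemma card_ge_le (p m c : ℕ) (hc : 2 * p ≤ m + c + 1) :
    ((Finset.range p ×ˢ Finset.range p).filter fun x => c ≤ x.1 + x.2).card ≤
      ((Finset.range p ×ˢ Finset.range p).filter fun x => x.1 + x.2 < m).card := by
  refine Finset.card_le_card_of_injOn (fun x => (p - 1 - x.1, p - 1 - x.2)) ?_ ?_
  · rintro ⟨i, j⟩ h
    simp only [Finset.coe_filter, Finset.mem_product, Finset.mem_range, Set.mem_ofPred_eq] at h ⊢
    omega
  · rintro ⟨i, j⟩ h ⟨i', j'⟩ h' he
    simp only [Finset.coe_filter, Finset.mem_product, Finset.mem_range, Set.mem_ofPred_eq,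
      Prod.mk.injEq] at h h' he ⊢
    omega

/-- Pairs in a square whose sum avoids two corners. -/
lemma two_mul_sq_le_card_strip (p c d m : ℕ) (hd : 2 * p ≤ m + d + 1) :
    2 * p ^ 2 ≤ 2 * ((Finset.range p ×ˢ Finset.range p).filter
      fun x => c ≤ x.1 + x.2 ∧ x.1 + x.2 < d).card + c * (c + 1) + m * (m + 1) := by
  classical
  have h1 := two_mul_card_lt_le p c
  have h2 := card_ge_le p m d hd
  have h3 := two_mul_card_lt_le p m
  have hcov : Finset.range p ×ˢ Finset.range p ⊆
      ((Finset.range p ×ˢ Finset.range p).filter fun x => c ≤ x.1 + x.2 ∧ x.1 + x.2 < d) ∪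
      (((Finset.range p ×ˢ Finset.range p).filter fun x => x.1 + x.2 < c) ∪
        ((Finset.range p ×ˢ Finset.range p).filter fun x => d ≤ x.1 + x.2)) := by
    intro x hx
    simp only [Finset.mem_union, Finset.mem_filter, hx, true_and]
    omega
  have h4 := (Finset.card_le_card hcov).trans ((Finset.card_union_le _ _).trans
    (Nat.add_le_add_left (Finset.card_union_le _ _) _))
  rw [Finset.card_product, Finset.card_range] at h4
  nlinarith

/-- A lattice point (i, j) is the right-angled vertex of up to two small triangles, with k = i + j -
s or k = i + j - s - 1. The range of k restricts each choice to a strip of the square, and the four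
missing corners are triangular numbers that pair up into (s + 1)² and u². -/
lemma two_mul_sq_le_card_gridTriples (p r s u : ℕ) (h : 2 * p = s + 1 + u + r) :
    2 * p ^ 2 ≤ (gridTriples p r s).card + (s + 1) ^ 2 + u ^ 2 := by
  classical
  have h0 := two_mul_sq_le_card_strip p s (s + r) u (by omega)
  -- Truncated subtraction is harmless: for u = 0 the upper corner is already empty.
  have h1 := two_mul_sq_le_card_strip p (s + 1) (s + 1 + r) (u - 1) (by omega)
  set A := (Finset.range p ×ˢ Finset.range p).filter
    fun x => s ≤ x.1 + x.2 ∧ x.1 + x.2 < s + r with hA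
  set B := (Finset.range p ×ˢ Finset.range p).filter
    fun x => s + 1 ≤ x.1 + x.2 ∧ x.1 + x.2 < s + 1 + r with hB
  have hAB : A.card + B.card ≤ (gridTriples p r s).card := by
    have hAi : (A.image fun x => (x.1, x.2, x.1 + x.2 - s)).card = A.card := by
      apply Finset.card_image_of_injective
      rintro ⟨i, j⟩ ⟨i', j'⟩ h
      simp only [Prod.mk.injEq] at h ⊢
      exact ⟨h.1, h.2.1⟩
    have hBi : (B.image fun x => (x.1, x.2, x.1 + x.2 - (s + 1))).card = B.card := by
      apply Finset.card_image_of_injective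
      rintro ⟨i, j⟩ ⟨i', j'⟩ h
      simp only [Prod.mk.injEq] at h ⊢
      exact ⟨h.1, h.2.1⟩
    rw [← hAi, ← hBi, ← Finset.card_union_of_disjoint]
    · apply Finset.card_le_card
      rintro ⟨i, j, k⟩ hx
      simp only [hA, hB, gridTriples, Finset.mem_union, Finset.mem_image, Finset.mem_filter,
        Finset.mem_product, Finset.mem_range, Prod.exists, Prod.mk.injEq] at hx ⊢
      rcases hx with ⟨i', j', hx, rfl, rfl, rfl⟩ | ⟨i', j', hx, rfl, rfl, rfl⟩ <;> omega
    · rw [Finset.disjoint_left]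
      rintro ⟨i, j, k⟩ hx hx'
      simp only [hA, hB, Finset.mem_image, Finset.mem_filter,
        Finset.mem_product, Finset.mem_range, Prod.exists, Prod.mk.injEq] at hx hx'
      obtain ⟨i', j', hx, rfl, rfl, rfl⟩ := hx
      obtain ⟨i'', j'', hx', rfl, rfl, he⟩ := hx'
      omega
  have hu : u * (u + 1) + (u - 1) * (u - 1 + 1) = 2 * u ^ 2 := by
    cases u with
    | zero => simp
    | succ u => simp only [Nat.add_sub_cancel]; ring
  nlinarith

/-! ### Choice of parameters and conclusion. -/

/-- Three families of about n/3 lines and cut corners of size about n/6 give roughly 2(n/3)² -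
2(n/6)² = n²/6 triangles. The exact choice depends on n mod 6; the strict inequality with slack 6 is
what passing to the floor needs. -/
lemma exists_tiling_parameters (n : ℕ) (hn : 6 ≤ n) : ∃ p r s u : ℕ, 2 * p + r = n ∧
    2 * p = s + 1 + u + r ∧ n ^ 2 + 6 * ((s + 1) ^ 2 + u ^ 2) < 12 * p ^ 2 + 6 + n := by
  obtain ⟨h, c, hc, rfl⟩ : ∃ h c, c < 6 ∧ n = 6 * h + c + 6 :=
    ⟨(n - 6) / 6, (n - 6) % 6, Nat.mod_lt _ (by norm_num), by omega⟩
  interval_cases c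
  · exact ⟨2 * h + 2, 2 * h + 2, h, h + 1, by omega, by omega, by nlinarith⟩
  · exact ⟨2 * h + 2, 2 * h + 3, h, h, by omega, by omega, by nlinarith⟩
  · exact ⟨2 * h + 3, 2 * h + 2, h + 1, h + 2, by omega, by omega, by nlinarith⟩
  · exact ⟨2 * h + 3, 2 * h + 3, h + 1, h + 1, by omega, by omega, by nlinarith⟩
  · exact ⟨2 * h + 3, 2 * h + 4, h, h + 1, by omega, by omega, by nlinarith⟩
  · exact ⟨2 * h + 4, 2 * h + 3, h + 2, h + 2, by omega, by omega, by nlinarith⟩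

lemma exists_minAreaCounts_ge (n : ℕ) (hn : 6 ≤ n) :
    ∃ k ∈ minAreaCounts n, n ^ 2 < 6 * k + 6 + n := by
  obtain ⟨p, r, s, u, h1, h2, h3⟩ := exists_tiling_parameters n hn
  refine ⟨_, ⟨tilingLines p r s, ⟨(card_tilingLines p r s).trans h1,
    fun a ha => isLine_of_mem_tilingLines ha⟩, rfl⟩, ?_⟩
  have h4 := two_mul_sq_le_card_gridTriples p r s u h2
  have h5 := card_gridTriples_le p r s
  linarith

lemma three_mul_le_of_mem_minAreaCounts {n k : ℕ} (hk : k ∈ minAreaCounts n) :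
    3 * k ≤ n * (n - 2) := by
  obtain ⟨L, ⟨rfl, hL⟩, rfl⟩ := hk
  exact three_mul_card_minAreaTriangles_le hL

theorem theorem2 (n : ℕ) (hn : 6 ≤ n) :
    IsGreatest (minAreaCounts n) (maxMinAreaTriangles n) ∧
      ⌊((n : ℝ) ^ 2 - n) / 6⌋ ≤ (maxMinAreaTriangles n : ℤ) ∧
      (maxMinAreaTriangles n : ℤ) ≤ ⌊((n : ℝ) ^ 2 - 2 * n) / 3⌋ := by
  obtain ⟨k, hk, hkn⟩ := exists_minAreaCounts_ge n hn
  have hbdd : BddAbove (minAreaCounts n) :=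
    ⟨n * (n - 2), fun m hm => by have := three_mul_le_of_mem_minAreaCounts hm; omega⟩
  have hmem : maxMinAreaTriangles n ∈ minAreaCounts n := Nat.sSup_mem ⟨k, hk⟩ hbdd
  refine ⟨⟨hmem, fun m hm => le_csSup hbdd hm⟩, ?_, ?_⟩
  · have hle : k ≤ maxMinAreaTriangles n := le_csSup hbdd hk
    have h1 : (k : ℝ) ≤ maxMinAreaTriangles n := by exact_mod_cast hle
    have h2 : (n : ℝ) ^ 2 < 6 * k + 6 + n := by exact_mod_cast hkn
    -- Over the integers it suffices that (n² - n)/6 is strictly below the maximum plus one, so the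
    -- rounding costs nothing.
    rw [← Int.lt_add_one_iff, Int.floor_lt]
    push_cast
    linarith
  · have h1 := three_mul_le_of_mem_minAreaCounts hmem
    have h2 : (3 * maxMinAreaTriangles n : ℝ) ≤ n * (n - 2 : ℕ) := by exact_mod_cast h1
    rw [Nat.cast_sub (by omega)] at h2
    rw [Int.le_floor]
    push_cast at h2 ⊢
    linarith
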